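/- Fix dimensions $n,d$. Consider the system $x_0=0$, $x_{t+1}=Ax_t+Bu_t+\omega_t$ with $A\in\mathbb R^{n\times n}$, $B\in\mathbb R^{n\times d}$, controlled by the Gaussian policy $u_t=Kx_t+\eta_t$, $K\in\mathbb R^{d\times n}$, where $\eta_t\sim N(0,\sigma^2I_d)$ with $\sigma>0$ and $\omega_t\sim N(0,D_\omega)$, $t\ge 0$, are all independent. Let $S\in\mathbb R^{n\times n}$, $R\in\mathbb R^{d\times d}$ be symmetric positive definite, $\gamma\in(0,1)$, $c_t=x_t^\top Sx_t+u_t^\top Ru_t$, $\widetilde\omega_t=B\eta_t+\omega_t$, $D_{\widetilde\omega}=\mathbb E[\widetilde\omega_t\widetilde\omega_t^\top]$, and $$J(K)=\sum_{t=0}^\infty\mathbb E\big[\gamma^t x_t^\top(S+K^\top RK)x_t\big]+\frac{\sigma^2\operatorname{Tr}R}{1-\gamma}.$$ Define the REINFORCE gradient and its truncated estimator ($L\in\{0,1,2,\dots\}$) by $$G(K)=\frac1{\sigma^2}\mathbb E\Big[\sum_{t=0}^\infty(u_t-Kx_t)x_t^\top\sum_{k=t}^\infty\gamma^kc_k\Big],\qquad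 \hat G^{(L)}(K)=\frac1{\sigma^2}\sum_{t=0}^L(u_t-Kx_t)x_t^\top\sum_{k=t}^L\gamma^kc_k .$$ Let $K$ be stable, i.e. the spectral radius $\rho(A+BK)$ is less than $1$. Then the series defining $J(K)$ converges, $J$ is differentiable at $K$, the series in $G(K)$ converge almost surely to an integrable random matrix, and $G(K)=\nabla J(K)$, where $\nabla J(K)$ is the matrix of partial derivatives of $J$ with respect to the entries of $K$. Moreover, for every $\rho\in(\rho(A+BK),1)$ and every $\Gamma_K>0$ such that $\|(A+BK)^k\|_2\le\Gamma_K\rho^k$ for all $k\ge1$, and for every $L$, the matrix $\hat G^{(L)}(K)$ is integrable with $\mathbb E\|\hat G^{(L)}(K)\|_F^2<\infty$, and $$\big\|\nabla J(K)-\mathbb E[\hat G^{(L)}(K)]\big\|_2\le C_2\,\frac{\Gamma_K^2}{1-\rho^2}\,\gamma^{L+1}\Big(\frac{\Gamma_K^2}{1-\rho^2}+\frac1{1-\gamma}\Big),\qquad \mathbb E\big\|\hat G^{(L)}(K)\big\|_F^2\le C_3\,\frac{L^3}{1-\gamma^2},$$ where $C_2$ depends only on $\|A\|_2,\|B\|_2,\|S\|_2,\|R\|_2,\|K\|_2,\Gamma_K,\frac1{1-\rho^2},D_{\widetilde\omega},n,d$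 and $(1-\gamma)J(K)$, and $C_3$ depends only on these quantities and on $\sigma$. -/

import Mathlib

open MeasureTheory ProbabilityTheory Matrix

noncomputable section

namespace LQR

/-- Spectral norm `‖M‖₂` (operator norm for the Euclidean norms). -/
def opNorm {m n : ℕ} (M : Matrix (Fin m) (Fin n) ℝ) : ℝ :=
  Matrix.instL2OpNormedAddCommGroup.toNorm.norm M

/-- Frobenius norm `‖M‖_F`. -/
def frobNorm {m n : ℕ} (M : Matrix (Fin m) (Fin n) ℝ) : ℝ :=
  Matrix.frobeniusNormedAddCommGroup.toNorm.norm M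

/-- The spectral radius of a real square matrix: the largest modulus of a complex eigenvalue. -/
def specRad {n : ℕ} (M : Matrix (Fin n) (Fin n) ℝ) : ENNReal :=
  spectralRadius ℂ (M.map (algebraMap ℝ ℂ))

/-- The policy `K` is stable: the closed-loop matrix `A + B K` has spectral radius `< 1`. -/
def StablePolicy {n d : ℕ} (A : Matrix (Fin n) (Fin n) ℝ) (B : Matrix (Fin n) (Fin d) ℝ)
    (K : Matrix (Fin d) (Fin n) ℝ) : Prop :=
  specRad (A + B * K) < 1

/-- The gradient of `f` at `K` for the Frobenius inner product, i.e. the matrix of the partial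
derivatives of `f` with respect to the entries of `K`. -/
def grad {d n : ℕ} (f : Matrix (Fin d) (Fin n) ℝ → ℝ) (K : Matrix (Fin d) (Fin n) ℝ) :
    Matrix (Fin d) (Fin n) ℝ :=
  Matrix.of fun i j => fderiv ℝ f K (Matrix.single i j 1)

/-- All entries of the random matrix `M` are integrable. -/
def IntegrableMat {Ω : Type*} [MeasurableSpace Ω] {m n : ℕ} (P : Measure Ω)
    (M : Ω → Matrix (Fin m) (Fin n) ℝ) : Prop :=
  ∀ i j, Integrable (fun ω => M ω i j) P

/-- Entrywise expectation of a random matrix. -/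
def expectMat {Ω : Type*} [MeasurableSpace Ω] {m n : ℕ} (P : Measure Ω)
    (M : Ω → Matrix (Fin m) (Fin n) ℝ) : Matrix (Fin m) (Fin n) ℝ :=
  Matrix.of fun i j => ∫ ω, M ω i j ∂P

/-- The randomness of the controlled system: `η t ∼ N(0, σ² I)` (exploration) and
`w t ∼ N(0, Dω)` (process noise), `t = 0, 1, …`, all of them independent. -/
structure IsNoise {Ω : Type*} [MeasurableSpace Ω] {n d : ℕ} (P : Measure Ω) (σ : ℝ)
    (Dω : Matrix (Fin n) (Fin n) ℝ) (η : ℕ → Ω → EuclideanSpace ℝ (Fin d))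
    (w : ℕ → Ω → EuclideanSpace ℝ (Fin n)) : Prop where
  measurable_η : ∀ t, Measurable (η t)
  measurable_w : ∀ t, Measurable (w t)
  law_η : ∀ t, HasLaw (η t) (multivariateGaussian 0 (σ ^ 2 • (1 : Matrix (Fin d) (Fin d) ℝ))) P
  law_w : ∀ t, HasLaw (w t) (multivariateGaussian 0 Dω) P
  indep_time : iIndepFun (fun t ω => (η t ω, w t ω)) P
  indep_pair : ∀ t, IndepFun (η t) (w t) P

/-- The covariance `D_ω̃ = E[ω̃ ω̃ᵀ]` of the effective noise `ω̃ₜ = B ηₜ + wₜ`. It is the same for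
all `t`, so it is taken at `t = 0`. -/
def effCov {Ω : Type*} [MeasurableSpace Ω] {n d : ℕ} (P : Measure Ω)
    (B : Matrix (Fin n) (Fin d) ℝ) (η : ℕ → Ω → EuclideanSpace ℝ (Fin d))
    (w : ℕ → Ω → EuclideanSpace ℝ (Fin n)) : Matrix (Fin n) (Fin n) ℝ :=
  expectMat P fun ω =>
    vecMulVec (B *ᵥ (η 0 ω).ofLp + (w 0 ω).ofLp) (B *ᵥ (η 0 ω).ofLp + (w 0 ω).ofLp)

section trajectory

variable {Ω : Type*} {n d : ℕ} (A : Matrix (Fin n) (Fin n) ℝ) (B : Matrix (Fin n) (Fin d) ℝ)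
  (S : Matrix (Fin n) (Fin n) ℝ) (R : Matrix (Fin d) (Fin d) ℝ) (γ σ : ℝ)
  (η : ℕ → Ω → EuclideanSpace ℝ (Fin d)) (w : ℕ → Ω → EuclideanSpace ℝ (Fin n))
  (K : Matrix (Fin d) (Fin n) ℝ)

/-- The state: `x₀ = 0`, `xₜ₊₁ = A xₜ + B uₜ + wₜ` with `uₜ = K xₜ + ηₜ`. -/
def state : ℕ → Ω → Fin n → ℝ
  | 0, _ => 0
  | t + 1, ω => A *ᵥ state t ω + B *ᵥ (K *ᵥ state t ω + (η t ω).ofLp) + (w t ω).ofLp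

/-- The control `uₜ = K xₜ + ηₜ`, i.e. `uₜ ∼ N(K xₜ, σ² I)` given the past. -/
def control (t : ℕ) (ω : Ω) : Fin d → ℝ :=
  K *ᵥ state A B η w K t ω + (η t ω).ofLp

/-- The cost `cₜ = xₜᵀ S xₜ + uₜᵀ R uₜ`. -/
def cost (t : ℕ) (ω : Ω) : ℝ :=
  state A B η w K t ω ⬝ᵥ S *ᵥ state A B η w K t ω +
    control A B η w K t ω ⬝ᵥ R *ᵥ control A B η w K t ω

/-- The sampled score term `(uₜ - K xₜ) xₜᵀ`. -/
def score (t : ℕ) (ω : Ω) : Matrix (Fin d) (Fin n) ℝ :=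
  vecMulVec (control A B η w K t ω - K *ᵥ state A B η w K t ω) (state A B η w K t ω)

/-- `J(K) = ∑ₜ E[γᵗ xₜᵀ (S + Kᵀ R K) xₜ] + σ² Tr(R) / (1 - γ)`. -/
def J [MeasurableSpace Ω] (P : Measure Ω) : ℝ :=
  (∑' t : ℕ, ∫ ω, γ ^ t *
    (state A B η w K t ω ⬝ᵥ (S + Kᵀ * R * K) *ᵥ state A B η w K t ω) ∂P) +
    σ ^ 2 * R.trace / (1 - γ)

/-- One term `(uₜ - K xₜ) xₜᵀ ∑_{k ≥ t} γᵏ cₖ`, with `k = t + j`. -/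
def returnTerm (ω : Ω) (t : ℕ) : Matrix (Fin d) (Fin n) ℝ :=
  (∑' j : ℕ, γ ^ (t + j) * cost A B S R η w K (t + j) ω) • score A B η w K t ω

/-- The pathwise infinite-horizon REINFORCE sample
`σ⁻² ∑_{t ≥ 0} (uₜ - K xₜ) xₜᵀ ∑_{k ≥ t} γᵏ cₖ`. -/
def fullSample (ω : Ω) : Matrix (Fin d) (Fin n) ℝ :=
  (1 / σ ^ 2) • ∑' t : ℕ, returnTerm A B S R γ η w K ω t

/-- The REINFORCE gradient
`G(K) = σ⁻² E[∑_{t ≥ 0} (uₜ - K xₜ) xₜᵀ ∑_{k ≥ t} γᵏ cₖ]`. -/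
def G [MeasurableSpace Ω] (P : Measure Ω) : Matrix (Fin d) (Fin n) ℝ :=
  expectMat P (fullSample A B S R γ σ η w K)

/-- The truncated estimator
`Ĝ⁽ᴸ⁾(K) = σ⁻² ∑_{t=0}^{L} (uₜ - K xₜ) xₜᵀ ∑_{k=t}^{L} γᵏ cₖ`. -/
def Ghat (L : ℕ) (ω : Ω) : Matrix (Fin d) (Fin n) ℝ :=
  (1 / σ ^ 2) • ∑ t ∈ Finset.Icc 0 L,
    (∑ k ∈ Finset.Icc t L, γ ^ k * cost A B S R η w K k ω) • score A B η w K t ω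

end trajectory

end LQR

end

/-! Write `M = A + B * K`. The closed loop is `x_{t+1} = M x_t + v_t` with i.i.d. centred Gaussian
`v_t = B η_t + w_t`, whose covariance `D` does not depend on `K`. Hence the state covariances
satisfy `Σ_{t+1} = M Σ_t Mᵀ + D`, and `J` is, up to a constant, the discounted series of `tr((S + Kᵀ
R K) Σ_t)`. Power bounds on `M` keep `Σ_t` and its derivative in `K` bounded uniformly in `t`. They
survive small perturbations of `K`, so the series can be differentiated term by term
(`exists_hasFDerivAt_tsum_costMean`).

The link with REINFORCE is an identity for each single cost, `sum_integral_score_mul_cost`: the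
scores up to time `k`, correlated with `c_k`, give `σ²` times the derivative of the mean of `c_k`.
The score at time `t` is `η_t x_tᵀ`. Its correlation with `x_{t+1} x_{t+1}ᵀ` comes only from the
part `B η_t` of the noise and equals `σ²` times the forcing term in the recursion for the derivative
of `Σ` (`weightedCov_score_succ_self`). Afterwards it is propagated by `X ↦ M X Mᵀ` without new
forcing, because the score has mean zero and is independent of later noise
(`weightedCov_state_succ`). Summing over `t < k` solves that recursion. The score at `t = k`
supplies the derivative of the explicit factor `Kᵀ R K`.

Eighth moments of states and noise are bounded uniformly in time, so products of scores and costs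
are bounded in `L²` (`integral_sq_score_mul_cost_le`). This gives absolute convergence of the double
series, hence `G = ∇J` after regrouping by cost time. The truncated estimator has as its mean a
partial sum of the gradient series, so its bias is a geometric tail. Two applications of
Cauchy–Schwarz give the second moment (`sq_Ghat_apply_le`). -/

namespace LQR

/-! ### Perturbation of power bounds in a normed ring -/

section PowerBounds

/-- Split each word of the noncommutative expansion at its leftmost `e`: powers of `a` stand before
it, arbitrary words after it. -/
theorem add_pow_eq_sum {R : Type*} [Ring R] (a e : R) (k : ℕ) :
    (a + e) ^ k = a ^ k + ∑ j ∈ Finset.range k, a ^ (k - 1 - j) * e * (a + e) ^ j := by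
  induction k with
  | zero => simp
  | succ k ih =>
    have h : ∑ j ∈ Finset.range k, a ^ (k - j) * e * (a + e) ^ j =
        a * ∑ j ∈ Finset.range k, a ^ (k - 1 - j) * e * (a + e) ^ j := by
      rw [Finset.mul_sum]
      refine Finset.sum_congr rfl fun j hj => ?_
      have : k - j = (k - 1 - j) + 1 := by have := Finset.mem_range.1 hj; omega
      rw [this, pow_succ']
      simp only [mul_assoc]
    rw [Finset.sum_range_succ, pow_succ' (a + e), add_mul]
    nth_rewrite 1 [ih]
    simp only [Nat.add_sub_cancel, Nat.sub_self, pow_zero, one_mul]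
    rw [h, mul_add, pow_succ' a]
    abel

/-- Power bounds are stable under perturbation. -/
theorem norm_add_pow_le {R : Type*} [NormedRing R] {a : R} (e : R) {c ρ : ℝ} (hc : 0 ≤ c)
    (hρ : 0 ≤ ρ) (h : ∀ k, ‖a ^ k‖ ≤ c * ρ ^ k) (k : ℕ) :
    ‖(a + e) ^ k‖ ≤ c * (ρ + c * ‖e‖) ^ k := by
  induction k using Nat.strong_induction_on with
  | _ k ih =>
    -- The same expansion is applied to the scalars `ρ` and `c * ‖e‖`, so the two sides can be
    -- compared term by term.
    rw [add_pow_eq_sum a e k, add_pow_eq_sum ρ (c * ‖e‖) k, mul_add, Finset.mul_sum]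
    refine (norm_add_le _ _).trans (add_le_add (h k) ((norm_sum_le _ _).trans ?_))
    refine Finset.sum_le_sum fun j hj => ?_
    calc ‖a ^ (k - 1 - j) * e * (a + e) ^ j‖
        ≤ ‖a ^ (k - 1 - j)‖ * ‖e‖ * ‖(a + e) ^ j‖ := norm_mul₃_le
      _ ≤ (c * ρ ^ (k - 1 - j)) * ‖e‖ * (c * (ρ + c * ‖e‖) ^ j) := by
          gcongr
          · exact h _
          · exact ih j (Finset.mem_range.1 hj)
      _ = _ := by ring

end PowerBounds

/-! ### Spectral norm, Gelfand's formula and the Lyapunov recursion -/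

section MatrixNorm

open scoped Matrix.Norms.L2Operator

theorem norm_matrix_le_sum {m n : ℕ} (M : Matrix (Fin m) (Fin n) ℝ) :
    ‖M‖ ≤ ∑ i, ∑ j, |M i j| * ‖(Matrix.single i j 1 : Matrix (Fin m) (Fin n) ℝ)‖ := by
  nth_rewrite 1 [Matrix.matrix_eq_sum_single M]
  refine (norm_sum_le _ _).trans (Finset.sum_le_sum fun i _ => (norm_sum_le _ _).trans
    (Finset.sum_le_sum fun j _ => ?_))
  have : Matrix.single i j (M i j) = M i j • (Matrix.single i j 1 : Matrix (Fin m) (Fin n) ℝ) := by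
    simp [Matrix.smul_single]
  rw [this, norm_smul, Real.norm_eq_abs]

theorem norm_matrix_transpose {m n : ℕ} (M : Matrix (Fin m) (Fin n) ℝ) : ‖Mᵀ‖ = ‖M‖ := by
  rw [← Matrix.conjTranspose_eq_transpose_of_trivial, Matrix.l2_opNorm_conjTranspose]

theorem norm_matrix_one_le (n : ℕ) : ‖(1 : Matrix (Fin n) (Fin n) ℝ)‖ ≤ 1 := by
  rw [← Matrix.diagonal_one, Matrix.l2_opNorm_diagonal]
  exact (pi_norm_le_iff_of_nonneg zero_le_one).2 fun i => by simp

/-- The norm of the trace functional for the spectral norm. -/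
noncomputable def traceNorm (n : ℕ) : ℝ :=
  ‖(Matrix.traceLinearMap (Fin n) ℝ ℝ).toContinuousLinearMap‖

theorem traceNorm_nonneg (n : ℕ) : 0 ≤ traceNorm n :=
  norm_nonneg (Matrix.traceLinearMap (Fin n) ℝ ℝ).toContinuousLinearMap

theorem abs_trace_le {n : ℕ} (M : Matrix (Fin n) (Fin n) ℝ) : |M.trace| ≤ traceNorm n * ‖M‖ :=
  (Matrix.traceLinearMap (Fin n) ℝ ℝ).toContinuousLinearMap.le_opNorm M

theorem opNorm_nonneg {m n : ℕ} (M : Matrix (Fin m) (Fin n) ℝ) : 0 ≤ opNorm M := norm_nonneg M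

/-- A matrix of spectral radius less than `ρ` has powers of size `O(ρ ^ k)`. -/
theorem exists_pow_bound_of_specRad_lt {n : ℕ} {M : Matrix (Fin n) (Fin n) ℝ} {ρ : ℝ}
    (hM : specRad M < ENNReal.ofReal ρ) : ∃ Γ : ℝ, 1 ≤ Γ ∧ ∀ k : ℕ, ‖M ^ k‖ ≤ Γ * ρ ^ k := by
  have hρ : 0 < ρ := ENNReal.ofReal_pos.1 (bot_lt_of_lt hM)
  set N : Matrix (Fin n) (Fin n) ℂ := M.map (algebraMap ℝ ℂ) with hN
  -- Gelfand's formula for the complexified matrix; its power bounds are carried back to `M` entry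
  -- by entry.
  have hlim := spectrum.pow_nnnorm_pow_one_div_tendsto_nhds_spectralRadius N
  have hev : ∀ᶠ k : ℕ in Filter.atTop, ‖N ^ k‖ ≤ ρ ^ k := by
    filter_upwards [hlim.eventually (gt_mem_nhds hM), Filter.eventually_gt_atTop 0] with k hk hk0
    have h1 : ((‖N ^ k‖₊ : ENNReal) ^ (1 / k : ℝ)) ^ (k : ℝ) ≤ (ENNReal.ofReal ρ) ^ (k : ℝ) :=
      ENNReal.rpow_le_rpow hk.le (Nat.cast_nonneg k)
    have hk' : (k : ℝ) ≠ 0 := by exact_mod_cast hk0.ne'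
    rw [← ENNReal.rpow_mul, one_div_mul_cancel hk', ENNReal.rpow_one, ENNReal.rpow_natCast,
      ← ENNReal.ofReal_pow hρ.le] at h1
    have h2 : ENNReal.ofReal ‖N ^ k‖ ≤ ENNReal.ofReal (ρ ^ k) := by
      rwa [ofReal_norm]
    exact (ENNReal.ofReal_le_ofReal_iff (by positivity)).1 h2
  have hentry : ∀ i j, ∃ c : ℝ, 0 ≤ c ∧ ∀ X : Matrix (Fin n) (Fin n) ℂ, ‖X i j‖ ≤ c * ‖X‖ :=
    fun i j => ⟨_, norm_nonneg _, (Matrix.entryLinearMap ℂ ℂ i j).toContinuousLinearMap.le_opNorm⟩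
  choose c hc0 hc using hentry
  set κ : ℝ := ∑ i, ∑ j, c i j * ‖(Matrix.single i j 1 : Matrix (Fin n) (Fin n) ℝ)‖ with hκ
  have hκ0 : 0 ≤ κ := Finset.sum_nonneg fun i _ => Finset.sum_nonneg fun j _ =>
    mul_nonneg (hc0 i j) (norm_nonneg _)
  have hle : ∀ k, ‖M ^ k‖ ≤ κ * ‖N ^ k‖ := by
    intro k
    refine (norm_matrix_le_sum _).trans ?_
    rw [hκ, Finset.sum_mul]
    refine Finset.sum_le_sum fun i _ => ?_
    rw [Finset.sum_mul]
    refine Finset.sum_le_sum fun j _ => ?_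
    have h1 : N ^ k = (M ^ k).map (algebraMap ℝ ℂ) := by
      rw [hN]; exact (Matrix.map_pow _ _ _).symm
    have h2 : |(M ^ k) i j| = ‖(N ^ k) i j‖ := by rw [h1]; simp
    rw [h2]
    calc _ ≤ (c i j * ‖N ^ k‖) * ‖(Matrix.single i j 1 : Matrix (Fin n) (Fin n) ℝ)‖ := by
          gcongr; exact hc i j _
      _ = _ := by ring
  obtain ⟨k₀, hk₀⟩ := Filter.eventually_atTop.1 hev
  have hpos : ∀ k, 0 < ρ ^ k := fun k => pow_pos hρ k
  -- `κ` serves the exponents `k ≥ k₀`, the finite sum serves `k < k₀`, and the summand `1` ensures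
  -- `1 ≤ Γ`.
  refine ⟨1 + κ + ∑ k ∈ Finset.range k₀, ‖M ^ k‖ / ρ ^ k, ?_, fun k => ?_⟩
  · have : 0 ≤ ∑ k ∈ Finset.range k₀, ‖M ^ k‖ / ρ ^ k :=
      Finset.sum_nonneg fun k _ => div_nonneg (norm_nonneg _) (hpos k).le
    linarith
  · rw [← div_le_iff₀ (hpos k)]
    by_cases hk : k < k₀
    · have := Finset.single_le_sum (f := fun k => ‖M ^ k‖ / ρ ^ k)
        (fun k _ => div_nonneg (norm_nonneg _) (hpos k).le) (Finset.mem_range.2 hk)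
      linarith
    · have : ‖M ^ k‖ / ρ ^ k ≤ κ := by
        rw [div_le_iff₀ (hpos k)]
        exact (hle k).trans (mul_le_mul_of_nonneg_left (hk₀ k (not_lt.1 hk)) hκ0)
      have h3 : 0 ≤ ∑ k ∈ Finset.range k₀, ‖M ^ k‖ / ρ ^ k :=
        Finset.sum_nonneg fun k _ => div_nonneg (norm_nonneg _) (hpos k).le
      linarith

theorem geom_sum_sq_le {ρ : ℝ} (h0 : 0 ≤ ρ) (h1 : ρ < 1) (t : ℕ) :
    ∑ s ∈ Finset.range t, (ρ ^ 2) ^ s ≤ 1 / (1 - ρ ^ 2) := by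
  have h : ρ ^ 2 < 1 := by nlinarith
  rw [one_div, ← tsum_geometric_of_lt_one (by positivity) h]
  exact (summable_geometric_of_lt_one (by positivity) h).sum_le_tsum _ fun i _ => by positivity

/-- A discrete Lyapunov recursion with bounded forcing stays bounded. -/
theorem norm_lyapunov_le {n : ℕ} {M : Matrix (Fin n) (Fin n) ℝ} {Γ ρ f : ℝ} (hρ0 : 0 ≤ ρ)
    (hρ1 : ρ < 1) (hM : ∀ k, ‖M ^ k‖ ≤ Γ * ρ ^ k) {Z F : ℕ → Matrix (Fin n) (Fin n) ℝ}
    (hZ0 : Z 0 = 0) (hZ : ∀ t, Z (t + 1) = M * Z t * Mᵀ + F t) (hF : ∀ t, ‖F t‖ ≤ f) (t : ℕ) :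
    ‖Z t‖ ≤ Γ ^ 2 * f * (1 / (1 - ρ ^ 2)) := by
  have hΓ : 0 ≤ Γ := by simpa using (norm_nonneg _).trans (hM 0)
  have hf : 0 ≤ f := (norm_nonneg _).trans (hF 0)
  -- Conjugation by `M ^ j` strengthens the induction so that only norms of powers of `M` occur.
  -- Iterating a bound on `‖M‖` itself would accumulate powers of `Γ`.
  have key : ∀ t j, ‖M ^ j * Z t * (M ^ j)ᵀ‖ ≤
      ∑ s ∈ Finset.range t, (Γ * ρ ^ (j + s)) ^ 2 * f := by
    intro t
    induction t with
    | zero => intro j; simp [hZ0]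
    | succ t ih =>
      intro j
      have h1 : M ^ j * Z (t + 1) * (M ^ j)ᵀ =
          M ^ (j + 1) * Z t * (M ^ (j + 1))ᵀ + M ^ j * F t * (M ^ j)ᵀ := by
        rw [hZ, mul_add, add_mul, pow_succ, Matrix.transpose_mul]
        simp only [Matrix.mul_assoc]
      rw [h1, Finset.sum_range_succ']
      refine (norm_add_le _ _).trans (add_le_add ?_ ?_)
      · refine (ih (j + 1)).trans (le_of_eq (Finset.sum_congr rfl fun s _ => ?_))
        rw [add_assoc, add_comm 1 s]
      · calc ‖M ^ j * F t * (M ^ j)ᵀ‖ ≤ ‖M ^ j‖ * ‖F t‖ * ‖(M ^ j)ᵀ‖ := norm_mul₃_le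
          _ ≤ (Γ * ρ ^ j) * f * (Γ * ρ ^ j) := by
            rw [norm_matrix_transpose]
            gcongr
            · exact hM j
            · exact hF t
            · exact hM j
          _ = _ := by rw [add_zero]; ring
  calc ‖Z t‖ = ‖M ^ 0 * Z t * (M ^ 0)ᵀ‖ := by simp
    _ ≤ _ := key t 0
    _ = Γ ^ 2 * f * ∑ s ∈ Finset.range t, (ρ ^ 2) ^ s := by
      rw [Finset.mul_sum]
      refine Finset.sum_congr rfl fun s _ => ?_
      rw [zero_add, ← pow_mul, mul_comm 2 s, pow_mul]; ring
    _ ≤ _ := by gcongr; exact geom_sum_sq_le hρ0 hρ1 t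

end MatrixNorm

/-! ### State covariances, their derivatives and the discounted series -/

section CovarianceRecursion

variable {n d : ℕ}

/-- The state covariances: `Σ₀ = 0` and `Σₜ₊₁ = M Σₜ Mᵀ + D`. -/
def covSeq (M D : Matrix (Fin n) (Fin n) ℝ) : ℕ → Matrix (Fin n) (Fin n) ℝ
  | 0 => 0
  | t + 1 => M * covSeq M D t * Mᵀ + D

/-- The derivative of `covSeq` with respect to `M` in the direction `E`. -/
def covDer (M D E : Matrix (Fin n) (Fin n) ℝ) : ℕ → Matrix (Fin n) (Fin n) ℝ
  | 0 => 0
  | t + 1 => M * covDer M D E t * Mᵀ + (E * covSeq M D t * Mᵀ + M * covSeq M D t * Eᵀ)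

/-- The part of the expected cost at time `t` that depends on the policy. -/
def costMean (A : Matrix (Fin n) (Fin n) ℝ) (B : Matrix (Fin n) (Fin d) ℝ)
    (S : Matrix (Fin n) (Fin n) ℝ) (R : Matrix (Fin d) (Fin d) ℝ) (D : Matrix (Fin n) (Fin n) ℝ)
    (t : ℕ) (K : Matrix (Fin d) (Fin n) ℝ) : ℝ :=
  ((S + Kᵀ * R * K) * covSeq (A + B * K) D t).trace

/-- The derivative of `costMean` in the direction `Δ`. -/
def costDer (A : Matrix (Fin n) (Fin n) ℝ) (B : Matrix (Fin n) (Fin d) ℝ)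
    (S : Matrix (Fin n) (Fin n) ℝ) (R : Matrix (Fin d) (Fin d) ℝ) (D : Matrix (Fin n) (Fin n) ℝ)
    (t : ℕ) (K Δ : Matrix (Fin d) (Fin n) ℝ) : ℝ :=
  ((Δᵀ * R * K + Kᵀ * R * Δ) * covSeq (A + B * K) D t).trace +
    ((S + Kᵀ * R * K) * covDer (A + B * K) D (B * Δ) t).trace

open scoped Matrix.Norms.L2Operator

variable {A : Matrix (Fin n) (Fin n) ℝ} {B : Matrix (Fin n) (Fin d) ℝ}
    {S : Matrix (Fin n) (Fin n) ℝ} {R : Matrix (Fin d) (Fin d) ℝ} {D : Matrix (Fin n) (Fin n) ℝ}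

/-- The product rule applied to the recursion. Stating it with an unnamed `L` avoids proving
separately that `covDer` is linear in `E`. -/
theorem hasFDerivAt_covSeq (D : Matrix (Fin n) (Fin n) ℝ) (t : ℕ)
    (M : Matrix (Fin n) (Fin n) ℝ) :
    ∃ L : Matrix (Fin n) (Fin n) ℝ →L[ℝ] Matrix (Fin n) (Fin n) ℝ,
      HasFDerivAt (fun M => covSeq M D t) L M ∧ ∀ E, L E = covDer M D E t := by
  induction t with
  | zero => exact ⟨0, hasFDerivAt_const _ _, fun E => by simp [covDer]⟩
  | succ t ih =>
    obtain ⟨L, hL, hLE⟩ := ih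
    have hT : HasFDerivAt (fun M : Matrix (Fin n) (Fin n) ℝ => Mᵀ)
        (Matrix.transposeLinearEquiv (Fin n) (Fin n) ℝ ℝ).toLinearMap.toContinuousLinearMap M :=
      (Matrix.transposeLinearEquiv (Fin n) (Fin n) ℝ ℝ).toLinearMap.toContinuousLinearMap.hasFDerivAt
    refine ⟨_, (((hasFDerivAt_id M).mul' hL).mul' hT).add_const D, fun E => ?_⟩
    simp [covDer, hLE, Matrix.mul_assoc]
    abel

theorem hasFDerivAt_costMean (A : Matrix (Fin n) (Fin n) ℝ) (B : Matrix (Fin n) (Fin d) ℝ)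
    (S : Matrix (Fin n) (Fin n) ℝ) (R : Matrix (Fin d) (Fin d) ℝ) (D : Matrix (Fin n) (Fin n) ℝ)
    (t : ℕ) (K : Matrix (Fin d) (Fin n) ℝ) :
    ∃ L : Matrix (Fin d) (Fin n) ℝ →L[ℝ] ℝ,
      HasFDerivAt (costMean A B S R D t) L K ∧ ∀ Δ, L Δ = costDer A B S R D t K Δ := by
  obtain ⟨L, hL, hLE⟩ := hasFDerivAt_covSeq D t (A + B * K)
  -- The factors are rectangular, so the product rule in a normed ring is not available; the
  -- quadratic term is the diagonal of a bounded bilinear map.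
  have hbil : IsBoundedBilinearMap ℝ
      (fun p : Matrix (Fin d) (Fin n) ℝ × Matrix (Fin d) (Fin n) ℝ => p.1ᵀ * R * p.2) :=
    { add_left := fun x y z => by simp [Matrix.add_mul]
      smul_left := fun c x y => by simp
      add_right := fun x y z => by simp [Matrix.mul_add]
      smul_right := fun c x y => by simp
      bound := ⟨‖R‖ + 1, by positivity, fun x y => by
        calc ‖xᵀ * R * y‖ ≤ ‖xᵀ * R‖ * ‖y‖ := Matrix.l2_opNorm_mul _ _
          _ ≤ (‖xᵀ‖ * ‖R‖) * ‖y‖ := by gcongr; exact Matrix.l2_opNorm_mul _ _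
          _ = ‖R‖ * ‖x‖ * ‖y‖ := by rw [norm_matrix_transpose]; ring
          _ ≤ (‖R‖ + 1) * ‖x‖ * ‖y‖ := by gcongr; linarith⟩ }
  have hQ : HasFDerivAt (fun K : Matrix (Fin d) (Fin n) ℝ => S + Kᵀ * R * K) _ K :=
    (HasFDerivAt.comp (f := fun K : Matrix (Fin d) (Fin n) ℝ => (K, K)) K
      (hbil.hasFDerivAt (K, K)) ((hasFDerivAt_id K).prodMk (hasFDerivAt_id K))).const_add S
  have haff : HasFDerivAt (fun K : Matrix (Fin d) (Fin n) ℝ => A + B * K)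
      (mulLeftLinearMap (Fin n) ℝ B).toContinuousLinearMap K :=
    ((mulLeftLinearMap (Fin n) ℝ B).toContinuousLinearMap.hasFDerivAt).const_add A
  have hX := hL.comp K haff
  have htr := (Matrix.traceLinearMap (Fin n) ℝ ℝ).toContinuousLinearMap.hasFDerivAt
    (x := (S + Kᵀ * R * K) * covSeq (A + B * K) D t)
  refine ⟨_, htr.comp K (hQ.mul' hX), fun Δ => ?_⟩
  simp [costDer, hLE, Matrix.add_mul]
  ring

/-- A bound for the derivative of the expected costs, uniform in time. -/
noncomputable def derBound (n : ℕ) (b s r k Γ κ : ℝ) (D : Matrix (Fin n) (Fin n) ℝ) : ℝ :=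
  traceNorm n * (2 * k * r * (Γ ^ 2 * ‖D‖ * κ) +
    (s + k ^ 2 * r) * (Γ ^ 2 * (2 * b * (Γ ^ 2 * ‖D‖ * κ) * Γ) * κ))

theorem norm_covSeq_le {M : Matrix (Fin n) (Fin n) ℝ} {Γ ρ : ℝ} (hρ0 : 0 ≤ ρ) (hρ1 : ρ < 1)
    (hM : ∀ k, ‖M ^ k‖ ≤ Γ * ρ ^ k) (t : ℕ) :
    ‖covSeq M D t‖ ≤ Γ ^ 2 * ‖D‖ * (1 / (1 - ρ ^ 2)) :=
  norm_lyapunov_le hρ0 hρ1 hM (F := fun _ => D) rfl (fun _ => rfl) (fun _ => le_rfl) t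

theorem norm_le_of_pow_bound {M : Matrix (Fin n) (Fin n) ℝ} {Γ ρ : ℝ} (hρ1 : ρ < 1)
    (hM : ∀ k, ‖M ^ k‖ ≤ Γ * ρ ^ k) : ‖M‖ ≤ Γ := by
  have hΓ : 0 ≤ Γ := by simpa using (norm_nonneg _).trans (hM 0)
  have := hM 1
  simp only [pow_one] at this
  nlinarith

/-- The forcing in the derivative recursion is linear in the covariances, which are already bounded,
so the Lyapunov estimate applies a second time. -/
theorem norm_covDer_le {M E : Matrix (Fin n) (Fin n) ℝ} {Γ ρ : ℝ} (hρ0 : 0 ≤ ρ) (hρ1 : ρ < 1)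
    (hM : ∀ k, ‖M ^ k‖ ≤ Γ * ρ ^ k) (t : ℕ) :
    ‖covDer M D E t‖ ≤
      Γ ^ 2 * (2 * ‖E‖ * (Γ ^ 2 * ‖D‖ * (1 / (1 - ρ ^ 2))) * Γ) * (1 / (1 - ρ ^ 2)) := by
  refine norm_lyapunov_le hρ0 hρ1 hM rfl (fun _ => rfl) (fun s => ?_) t
  have h1 := norm_covSeq_le (D := D) hρ0 hρ1 hM s
  have h2 := norm_le_of_pow_bound hρ1 hM
  have hΓ : 0 ≤ Γ := (norm_nonneg _).trans h2
  set u := Γ ^ 2 * ‖D‖ * (1 / (1 - ρ ^ 2))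
  have hu : 0 ≤ u := (norm_nonneg _).trans h1
  calc _ ≤ ‖E‖ * ‖covSeq M D s‖ * ‖Mᵀ‖ + ‖M‖ * ‖covSeq M D s‖ * ‖Eᵀ‖ :=
        (norm_add_le _ _).trans (add_le_add norm_mul₃_le norm_mul₃_le)
    _ ≤ ‖E‖ * u * Γ + Γ * u * ‖E‖ := by
        rw [norm_matrix_transpose, norm_matrix_transpose]; gcongr
    _ = _ := by ring

theorem norm_transpose_mul_mul_le {n₁ n₂ : ℕ} (X : Matrix (Fin d) (Fin n₁) ℝ)
    (Y : Matrix (Fin d) (Fin n₂) ℝ) : ‖Xᵀ * R * Y‖ ≤ ‖X‖ * ‖R‖ * ‖Y‖ :=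
  calc ‖Xᵀ * R * Y‖ ≤ ‖Xᵀ * R‖ * ‖Y‖ := Matrix.l2_opNorm_mul _ _
    _ ≤ (‖Xᵀ‖ * ‖R‖) * ‖Y‖ := by gcongr; exact Matrix.l2_opNorm_mul _ _
    _ = ‖X‖ * ‖R‖ * ‖Y‖ := by rw [norm_matrix_transpose]

/-- The bound `k` on `‖K‖` is a free parameter so that one constant serves a whole ball of policies.
Nothing on the right depends on `t`, which leaves the discount to make the series converge. -/
theorem abs_costDer_le {K : Matrix (Fin d) (Fin n) ℝ} {Γ ρ k : ℝ} (hρ0 : 0 ≤ ρ) (hρ1 : ρ < 1)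
    (hM : ∀ k, ‖(A + B * K) ^ k‖ ≤ Γ * ρ ^ k) (hk : ‖K‖ ≤ k) (t : ℕ)
    (Δ : Matrix (Fin d) (Fin n) ℝ) :
    |costDer A B S R D t K Δ| ≤ derBound n ‖B‖ ‖S‖ ‖R‖ k Γ (1 / (1 - ρ ^ 2)) D * ‖Δ‖ := by
  have h1 := norm_covSeq_le (D := D) hρ0 hρ1 hM t
  have h2 := norm_covDer_le (D := D) (E := B * Δ) hρ0 hρ1 hM t
  have h3 : ‖B * Δ‖ ≤ ‖B‖ * ‖Δ‖ := Matrix.l2_opNorm_mul _ _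
  have hΓ : 0 ≤ Γ := (norm_nonneg _).trans (norm_le_of_pow_bound hρ1 hM)
  have hk0 : 0 ≤ k := (norm_nonneg _).trans hk
  have hτ := traceNorm_nonneg n
  unfold costDer derBound
  set κ := 1 / (1 - ρ ^ 2)
  have hκ : 0 ≤ κ := by
    have : ρ ^ 2 < 1 := by nlinarith
    exact one_div_nonneg.2 (by linarith)
  set u := Γ ^ 2 * ‖D‖ * κ
  have hu : 0 ≤ u := (norm_nonneg _).trans h1
  have e1 : ‖(Δᵀ * R * K + Kᵀ * R * Δ) * covSeq (A + B * K) D t‖ ≤ 2 * k * ‖R‖ * u * ‖Δ‖ :=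
    calc _ ≤ ‖Δᵀ * R * K + Kᵀ * R * Δ‖ * ‖covSeq (A + B * K) D t‖ := norm_mul_le _ _
      _ ≤ (‖Δ‖ * ‖R‖ * ‖K‖ + ‖K‖ * ‖R‖ * ‖Δ‖) * u := by
          gcongr
          exact (norm_add_le _ _).trans
            (add_le_add (norm_transpose_mul_mul_le _ _) (norm_transpose_mul_mul_le _ _))
      _ ≤ (‖Δ‖ * ‖R‖ * k + k * ‖R‖ * ‖Δ‖) * u := by gcongr
      _ = _ := by ring
  have e2 : ‖(S + Kᵀ * R * K) * covDer (A + B * K) D (B * Δ) t‖ ≤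
      (‖S‖ + k ^ 2 * ‖R‖) * (Γ ^ 2 * (2 * (‖B‖ * ‖Δ‖) * u * Γ) * κ) :=
    calc _ ≤ ‖S + Kᵀ * R * K‖ * ‖covDer (A + B * K) D (B * Δ) t‖ := norm_mul_le _ _
      _ ≤ (‖S‖ + k * ‖R‖ * k) * (Γ ^ 2 * (2 * (‖B‖ * ‖Δ‖) * u * Γ) * κ) := by
          gcongr
          · refine (norm_add_le _ _).trans (add_le_add le_rfl ?_)
            refine (norm_transpose_mul_mul_le _ _).trans ?_
            gcongr
          · refine h2.trans ?_
            gcongr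
      _ = _ := by ring
  calc _ ≤ traceNorm n * (2 * k * ‖R‖ * u * ‖Δ‖) +
      traceNorm n * ((‖S‖ + k ^ 2 * ‖R‖) * (Γ ^ 2 * (2 * (‖B‖ * ‖Δ‖) * u * Γ) * κ)) := by
        refine (abs_add_le _ _).trans (add_le_add ?_ ?_)
        · exact (abs_trace_le _).trans (by gcongr)
        · exact (abs_trace_le _).trans (by gcongr)
    _ = _ := by ring

theorem derBound_nonneg {b s r k Γ κ : ℝ} (hb : 0 ≤ b) (hs : 0 ≤ s) (hr : 0 ≤ r) (hk : 0 ≤ k)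
    (hΓ : 0 ≤ Γ) (hκ : 0 ≤ κ) (D : Matrix (Fin n) (Fin n) ℝ) :
    0 ≤ derBound n b s r k Γ κ D := by
  have := traceNorm_nonneg n
  unfold derBound
  positivity

theorem abs_costMean_le {K : Matrix (Fin d) (Fin n) ℝ} {Γ ρ : ℝ} (hρ0 : 0 ≤ ρ) (hρ1 : ρ < 1)
    (hM : ∀ k, ‖(A + B * K) ^ k‖ ≤ Γ * ρ ^ k) (t : ℕ) :
    |costMean A B S R D t K| ≤
      traceNorm n * (‖S + Kᵀ * R * K‖ * (Γ ^ 2 * ‖D‖ * (1 / (1 - ρ ^ 2)))) := by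
  refine (abs_trace_le _).trans ?_
  have hτ := traceNorm_nonneg n
  gcongr
  refine (norm_mul_le _ _).trans ?_
  gcongr
  exact norm_covSeq_le hρ0 hρ1 hM t

/-- Term-by-term differentiation of a discounted series. -/
theorem exists_hasFDerivAt_tsum_of_bound {E : Type*} [NormedAddCommGroup E] [NormedSpace ℝ E]
    {f : ℕ → E → ℝ} {f' : ℕ → E → E → ℝ} {x : E} {ε C γ : ℝ} (hγ0 : 0 ≤ γ) (hγ1 : γ < 1)
    (hε : 0 < ε) (hC : 0 ≤ C)
    (hf : ∀ t y, ∃ L : E →L[ℝ] ℝ, HasFDerivAt (f t) L y ∧ ∀ v, L v = f' t y v)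
    (hb : ∀ t, ∀ y ∈ Metric.ball x ε, ∀ v, |f' t y v| ≤ C * ‖v‖)
    (hs : Summable fun t => γ ^ t * f t x) :
    ∃ L : E →L[ℝ] ℝ, HasFDerivAt (fun y => ∑' t, γ ^ t * f t y) L x ∧
      ∀ v, HasSum (fun t => γ ^ t * f' t x v) (L v) := by
  choose L hL hLv using hf
  have hu : Summable fun t : ℕ => γ ^ t * C :=
    (summable_geometric_of_lt_one hγ0 hγ1).mul_right C
  have hLb : ∀ t, ∀ y ∈ Metric.ball x ε, ‖γ ^ t • L t y‖ ≤ γ ^ t * C := by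
    intro t y hy
    rw [norm_smul, norm_pow, Real.norm_of_nonneg hγ0]
    gcongr
    refine ContinuousLinearMap.opNorm_le_bound _ hC fun v => ?_
    rw [hLv, Real.norm_eq_abs]
    exact hb t y hy v
  have hx : x ∈ Metric.ball x ε := Metric.mem_ball_self hε
  refine ⟨∑' t, γ ^ t • L t x, ?_, fun v => ?_⟩
  · exact hasFDerivAt_tsum_of_isPreconnected hu Metric.isOpen_ball
      (convex_ball x ε).isPreconnected
      (fun t y _ => (hL t y).const_mul (γ ^ t)) hLb hx hs hx
  · have hsum : Summable fun t => γ ^ t • L t x :=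
      Summable.of_norm_bounded hu fun t => hLb t x hx
    have := (ContinuousLinearMap.apply ℝ ℝ v).hasSum hsum.hasSum
    simpa [hLv] using this

/-- The discounted cost is differentiable at a stable policy, and the differentiation may be
carried out term by term. -/
theorem exists_hasFDerivAt_tsum_costMean {K : Matrix (Fin d) (Fin n) ℝ} {γ Γ ρ : ℝ} (hγ0 : 0 ≤ γ)
    (hγ1 : γ < 1) (hρ0 : 0 ≤ ρ) (hρ1 : ρ < 1) (hM : ∀ k, ‖(A + B * K) ^ k‖ ≤ Γ * ρ ^ k) :
    ∃ L : Matrix (Fin d) (Fin n) ℝ →L[ℝ] ℝ,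
      HasFDerivAt (fun K' => ∑' t, γ ^ t * costMean A B S R D t K') L K ∧
      ∀ Δ, HasSum (fun t => γ ^ t * costDer A B S R D t K Δ) (L Δ) := by
  have hΓ : 0 ≤ Γ := (norm_nonneg _).trans (norm_le_of_pow_bound hρ1 hM)
  -- This radius makes `Γ * ‖B‖ * ε ≤ (1 - ρ) / 2`, so the perturbed rate `r` is at most `(1 + ρ) /
  -- 2`. The `+ 1` guards against a zero denominator.
  set ε : ℝ := (1 - ρ) / (2 * (Γ * ‖B‖ + 1)) with hε
  have hden : 0 < Γ * ‖B‖ + 1 := by positivity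
  have hε0 : 0 < ε := div_pos (by linarith) (by positivity)
  set r : ℝ := ρ + Γ * (‖B‖ * ε) with hr
  have hr0 : 0 ≤ r := by positivity
  have hr1 : r < 1 := by
    have h1 : Γ * ‖B‖ * ε ≤ (Γ * ‖B‖ + 1) * ε := by gcongr; linarith
    have h2 : (Γ * ‖B‖ + 1) * ε = (1 - ρ) / 2 := by rw [hε]; field_simp
    have h3 : Γ * (‖B‖ * ε) = Γ * ‖B‖ * ε := by ring
    rw [hr, h3]; linarith
  have hpow : ∀ K' ∈ Metric.ball K ε, ∀ k, ‖(A + B * K') ^ k‖ ≤ Γ * r ^ k := by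
    intro K' hK' k
    have hd : ‖K' - K‖ < ε := by rwa [← dist_eq_norm]
    have h1 : A + B * K' = (A + B * K) + B * (K' - K) := by rw [Matrix.mul_sub]; abel
    rw [h1]
    refine (norm_add_pow_le _ hΓ hρ0 hM k).trans ?_
    have h2 : ‖B * (K' - K)‖ ≤ ‖B‖ * ε :=
      (Matrix.l2_opNorm_mul _ _).trans (by gcongr)
    rw [hr]
    gcongr
  set C := derBound n ‖B‖ ‖S‖ ‖R‖ (‖K‖ + ε) Γ (1 / (1 - r ^ 2)) D with hC
  have hC0 : 0 ≤ C := by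
    have : r ^ 2 < 1 := by nlinarith
    exact derBound_nonneg (norm_nonneg _) (norm_nonneg _) (norm_nonneg _) (by positivity) hΓ
      (one_div_nonneg.2 (by linarith)) D
  have hsum0 : Summable fun t => γ ^ t * costMean A B S R D t K := by
    refine Summable.of_norm_bounded (g := fun t : ℕ => γ ^ t *
      (traceNorm n * (‖S + Kᵀ * R * K‖ * (Γ ^ 2 * ‖D‖ * (1 / (1 - ρ ^ 2))))))
      ((summable_geometric_of_lt_one hγ0 hγ1).mul_right _) fun t => ?_
    rw [norm_mul, norm_pow, Real.norm_of_nonneg hγ0]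
    gcongr
    exact abs_costMean_le hρ0 hρ1 hM t
  refine exists_hasFDerivAt_tsum_of_bound hγ0 hγ1 hε0 hC0
    (hasFDerivAt_costMean A B S R D) (fun t K' hK' Δ => ?_) hsum0
  refine abs_costDer_le hr0 hr1 (hpow K' hK') ?_ t Δ
  have hd : ‖K' - K‖ < ε := by rwa [← dist_eq_norm]
  have : ‖K'‖ ≤ ‖K‖ + ‖K' - K‖ := by
    simpa using norm_add_le K (K' - K)
  linarith

end CovarianceRecursion

end LQR

namespace LQR

/-! ### Random variables with all moments, and weighted second moments -/

section Moments

variable {Ω : Type*} [MeasurableSpace Ω] {P : Measure Ω}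

/-- All absolute moments of `f` are finite. -/
def HasAllMoments (f : Ω → ℝ) (P : Measure Ω) : Prop := ∀ p : ENNReal, p ≠ ⊤ → MemLp f p P

namespace HasAllMoments

variable {f g : Ω → ℝ}

theorem integrable (hf : HasAllMoments f P) : Integrable f P :=
  memLp_one_iff_integrable.1 (hf 1 ENNReal.one_ne_top)

theorem const [IsFiniteMeasure P] (c : ℝ) : HasAllMoments (fun _ : Ω => c) P :=
  fun _ _ => memLp_const c

theorem add (hf : HasAllMoments f P) (hg : HasAllMoments g P) :
    HasAllMoments (fun ω => f ω + g ω) P := fun p hp => (hf p hp).add (hg p hp)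

/-- Hölder with both exponents `2p`. Closure under products is the reason for asking for every
finite exponent: polynomials in the noise become integrable without bookkeeping. -/
theorem mul (hf : HasAllMoments f P) (hg : HasAllMoments g P) :
    HasAllMoments (fun ω => f ω * g ω) P := fun p hp => by
  have h : ENNReal.HolderTriple (p * 2) (p * 2) p := ⟨by
    rw [ENNReal.mul_inv (by simp) (by simp), ← mul_add, ENNReal.inv_two_add_inv_two, mul_one]⟩
  have hp2 : p * 2 ≠ ⊤ := ENNReal.mul_ne_top hp (by simp)
  exact (hg _ hp2).mul (hf _ hp2)

theorem const_mul (c : ℝ) (hf : HasAllMoments f P) : HasAllMoments (fun ω => c * f ω) P :=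
  fun p hp => (hf p hp).const_mul c

theorem pow [IsFiniteMeasure P] (hf : HasAllMoments f P) (k : ℕ) :
    HasAllMoments (fun ω => f ω ^ k) P := by
  induction k with
  | zero => simpa using const 1
  | succ k ih => simpa only [pow_succ] using ih.mul hf

theorem sum {ι : Type*} {s : Finset ι} {F : ι → Ω → ℝ}
    (h : ∀ i ∈ s, HasAllMoments (F i) P) : HasAllMoments (fun ω => ∑ i ∈ s, F i ω) P :=
  fun p hp => by
    simpa using memLp_finsetSum (f := F) s fun i hi => h i hi p hp

theorem dotProduct {m : Type*} [Fintype m] {x y : Ω → m → ℝ}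
    (hx : ∀ i, HasAllMoments (fun ω => x ω i) P) (hy : ∀ i, HasAllMoments (fun ω => y ω i) P) :
    HasAllMoments (fun ω => x ω ⬝ᵥ y ω) P :=
  sum fun i _ => (hx i).mul (hy i)

theorem mulVec {m l : Type*} [Fintype m] (M : Matrix l m ℝ) {x : Ω → m → ℝ}
    (hx : ∀ i, HasAllMoments (fun ω => x ω i) P) (i : l) :
    HasAllMoments (fun ω => (M *ᵥ x ω) i) P :=
  sum fun j _ => (hx j).const_mul (M i j)

end HasAllMoments

theorem integral_mul_bilin {m l : Type*} [Fintype m] [Fintype l] {φ : Ω → ℝ} {p : Ω → m → ℝ}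
    {q : Ω → l → ℝ} (hφ : HasAllMoments φ P) (hp : ∀ i, HasAllMoments (fun ω => p ω i) P)
    (hq : ∀ i, HasAllMoments (fun ω => q ω i) P) (Q : Matrix m l ℝ) :
    ∫ ω, φ ω * (p ω ⬝ᵥ Q *ᵥ q ω) ∂P = ∑ a, ∑ b, Q a b * ∫ ω, φ ω * (p ω a * q ω b) ∂P := by
  have h1 : ∀ ω, φ ω * (p ω ⬝ᵥ Q *ᵥ q ω) = ∑ a, ∑ b, Q a b * (φ ω * (p ω a * q ω b)) := by
    intro ω
    simp only [dotProduct, Matrix.mulVec, Finset.mul_sum]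
    exact Finset.sum_congr rfl fun a _ => Finset.sum_congr rfl fun b _ => by ring
  have h2 : ∀ a b, Integrable (fun ω => Q a b * (φ ω * (p ω a * q ω b))) P := fun a b =>
    ((hφ.mul ((hp a).mul (hq b))).const_mul _).integrable
  simp only [h1]
  rw [integral_finsetSum _ fun a _ => integrable_finsetSum _ fun b _ => h2 a b]
  refine Finset.sum_congr rfl fun a _ => ?_
  rw [integral_finsetSum _ fun b _ => h2 a b]
  exact Finset.sum_congr rfl fun b _ => integral_const_mul _ _

/-- The second moment matrix of `x` weighted by `φ`. -/
noncomputable def weightedCov {n : ℕ} (P : Measure Ω) (φ : Ω → ℝ) (x : Ω → Fin n → ℝ) :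
    Matrix (Fin n) (Fin n) ℝ :=
  Matrix.of fun a b => ∫ ω, φ ω * (x ω a * x ω b) ∂P

theorem integral_mul_quad {n : ℕ} {φ : Ω → ℝ} {x : Ω → Fin n → ℝ} (hφ : HasAllMoments φ P)
    (hx : ∀ i, HasAllMoments (fun ω => x ω i) P) (Q : Matrix (Fin n) (Fin n) ℝ) :
    ∫ ω, φ ω * (x ω ⬝ᵥ Q *ᵥ x ω) ∂P = (Q * weightedCov P φ x).trace := by
  rw [integral_mul_bilin hφ hx hx]
  simp only [Matrix.trace, Matrix.diag, Matrix.mul_apply, weightedCov, Matrix.of_apply]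
  refine Finset.sum_congr rfl fun a _ => Finset.sum_congr rfl fun b _ => ?_
  congr 1
  exact integral_congr_ae (.of_forall fun ω => by simp only; ring)

theorem weightedCov_mulVec {n m : ℕ} {φ : Ω → ℝ} {x : Ω → Fin n → ℝ} (hφ : HasAllMoments φ P)
    (hx : ∀ i, HasAllMoments (fun ω => x ω i) P) (M : Matrix (Fin m) (Fin n) ℝ) :
    weightedCov P φ (fun ω => M *ᵥ x ω) = M * weightedCov P φ x * Mᵀ := by
  ext a b
  have h1 : ∀ ω, φ ω * ((M *ᵥ x ω) a * (M *ᵥ x ω) b) =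
      φ ω * (x ω ⬝ᵥ (vecMulVec (M a) (M b)) *ᵥ x ω) := by
    intro ω
    simp only [Matrix.mulVec, dotProduct, vecMulVec_apply, Finset.mul_sum, Finset.sum_mul]
    rw [Finset.sum_comm]
    exact Finset.sum_congr rfl fun i _ => Finset.sum_congr rfl fun j _ => by ring
  simp only [weightedCov, Matrix.of_apply, h1]
  rw [integral_mul_bilin hφ hx hx]
  simp only [Matrix.mul_apply, Matrix.of_apply, vecMulVec_apply, Matrix.transpose_apply,
    Finset.sum_mul]
  rw [Finset.sum_comm]
  exact Finset.sum_congr rfl fun i _ => Finset.sum_congr rfl fun j _ => by ring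

end Moments

/-! ### The closed loop and its filtration -/

section Trajectory

variable {Ω : Type*} {n d : ℕ}

/-- The effective noise `B ηₜ + wₜ`. -/
def noise (B : Matrix (Fin n) (Fin d) ℝ) (η : ℕ → Ω → EuclideanSpace ℝ (Fin d))
    (w : ℕ → Ω → EuclideanSpace ℝ (Fin n)) (t : ℕ) (ω : Ω) : Fin n → ℝ :=
  B *ᵥ (η t ω).ofLp + (w t ω).ofLp

variable (A : Matrix (Fin n) (Fin n) ℝ) (B : Matrix (Fin n) (Fin d) ℝ)
  (S : Matrix (Fin n) (Fin n) ℝ) (R : Matrix (Fin d) (Fin d) ℝ)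
  (η : ℕ → Ω → EuclideanSpace ℝ (Fin d)) (w : ℕ → Ω → EuclideanSpace ℝ (Fin n))
  (K : Matrix (Fin d) (Fin n) ℝ)

theorem state_succ (t : ℕ) (ω : Ω) : state A B η w K (t + 1) ω =
    (A + B * K) *ᵥ state A B η w K t ω + noise B η w t ω := by
  simp only [state, noise, Matrix.add_mulVec, Matrix.mulVec_add, Matrix.mulVec_mulVec]
  abel

theorem score_apply (t : ℕ) (ω : Ω) (i : Fin d) (j : Fin n) :
    score A B η w K t ω i j = (η t ω).ofLp i * state A B η w K t ω j := by
  simp [score, control, vecMulVec_apply]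

/-- Sorting by degree in `η t` prepares for conditioning: the state is determined by earlier noise,
while `η t` is fresh. -/
theorem cost_eq (t : ℕ) (ω : Ω) : cost A B S R η w K t ω =
    state A B η w K t ω ⬝ᵥ (S + Kᵀ * R * K) *ᵥ state A B η w K t ω +
      ((η t ω).ofLp ⬝ᵥ (R * K) *ᵥ state A B η w K t ω +
        state A B η w K t ω ⬝ᵥ (Kᵀ * R) *ᵥ (η t ω).ofLp) +
      (η t ω).ofLp ⬝ᵥ R *ᵥ (η t ω).ofLp := by
  have h : ∀ (x : Fin n → ℝ) (y : Fin d → ℝ), (K *ᵥ x) ⬝ᵥ y = x ⬝ᵥ Kᵀ *ᵥ y := by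
    intro x y
    rw [dotProduct_comm, dotProduct_mulVec, ← mulVec_transpose, dotProduct_comm]
  simp only [cost, control, Matrix.add_mulVec, Matrix.mulVec_add, dotProduct_add, add_dotProduct,
    h, ← Matrix.mulVec_mulVec]
  ring

variable {A B S R η w K}

theorem measurable_noise {m : MeasurableSpace Ω} {t : ℕ} (hη : Measurable (η t))
    (hw : Measurable (w t)) : Measurable (noise B η w t) := by
  unfold noise
  refine measurable_pi_lambda _ fun i => ?_
  simp only [Pi.add_apply, Matrix.mulVec, dotProduct]
  fun_prop

theorem measurable_mulVec {m : MeasurableSpace Ω} {p q : ℕ} (M : Matrix (Fin p) (Fin q) ℝ)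
    {x : Ω → Fin q → ℝ} (hx : Measurable x) : Measurable fun ω => M *ᵥ x ω := by
  refine measurable_pi_lambda _ fun i => ?_
  simp only [Matrix.mulVec, dotProduct]
  fun_prop

/-- The `σ`-algebra is arbitrary and only noise before `t` is required, so the choice `past η w t`
yields adaptedness. -/
theorem measurable_state {m : MeasurableSpace Ω} {t : ℕ} (hη : ∀ s < t, Measurable (η s))
    (hw : ∀ s < t, Measurable (w s)) : Measurable (state A B η w K t) := by
  induction t with
  | zero => exact measurable_const
  | succ t ih =>
    have h : state A B η w K (t + 1) =
        fun ω => (A + B * K) *ᵥ state A B η w K t ω + noise B η w t ω :=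
      funext (state_succ A B η w K t)
    rw [h]
    exact (measurable_mulVec _ (ih (fun s hs => hη s (by omega)) fun s hs => hw s (by omega))).add
      (measurable_noise (hη t (by omega)) (hw t (by omega)))

/-- The `σ`-algebra of the noise before time `t`. -/
abbrev past (η : ℕ → Ω → EuclideanSpace ℝ (Fin d)) (w : ℕ → Ω → EuclideanSpace ℝ (Fin n)) (t : ℕ) :
    MeasurableSpace Ω :=
  ⨆ s ∈ Set.Iio t, MeasurableSpace.comap (fun ω => (η s ω, w s ω)) inferInstance

/-- The `σ`-algebra of the noise at time `t`. -/
abbrev present (η : ℕ → Ω → EuclideanSpace ℝ (Fin d)) (w : ℕ → Ω → EuclideanSpace ℝ (Fin n))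
    (t : ℕ) : MeasurableSpace Ω :=
  MeasurableSpace.comap (fun ω => (η t ω, w t ω)) inferInstance

theorem measurable_present (t : ℕ) :
    Measurable[present η w t] fun ω => (η t ω, w t ω) :=
  comap_measurable _

theorem measurable_past {s t : ℕ} (h : s < t) :
    Measurable[past η w t] fun ω => (η s ω, w s ω) :=
  (comap_measurable _).mono (le_iSup₂ (f := fun s (_ : s ∈ Set.Iio t) =>
    MeasurableSpace.comap (fun ω => (η s ω, w s ω)) inferInstance) s h) le_rfl

theorem measurable_present_η (t : ℕ) (i : Fin d) :
    Measurable[present η w t] fun ω => (η t ω).ofLp i := by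
  have h : Measurable fun p : EuclideanSpace ℝ (Fin d) × EuclideanSpace ℝ (Fin n) =>
    p.1.ofLp i := by fun_prop
  exact h.comp (measurable_present t)

theorem measurable_present_noise (t : ℕ) (a : Fin n) :
    Measurable[present η w t] fun ω => noise B η w t ω a := by
  have h : Measurable fun p : EuclideanSpace ℝ (Fin d) × EuclideanSpace ℝ (Fin n) =>
      (B *ᵥ p.1.ofLp + p.2.ofLp) a := by
    simp only [Pi.add_apply, Matrix.mulVec, dotProduct]
    fun_prop
  exact h.comp (measurable_present t)

theorem measurable_past_η {s t : ℕ} (h : s < t) (i : Fin d) :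
    Measurable[past η w t] fun ω => (η s ω).ofLp i := by
  have h' : Measurable fun p : EuclideanSpace ℝ (Fin d) × EuclideanSpace ℝ (Fin n) =>
    p.1.ofLp i := by fun_prop
  exact h'.comp (measurable_past h)

theorem measurable_past_state {s t : ℕ} (h : s ≤ t) :
    Measurable[past η w t] (state A B η w K s) :=
  measurable_state (m := past η w t)
    (fun _ hr => (measurable_fst.comp (measurable_past (hr.trans_le h))))
    (fun _ hr => (measurable_snd.comp (measurable_past (hr.trans_le h))))

end Trajectory

set_option linter.unusedSectionVars false

/-! ### Independence and second moments of the noise -/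

section Noise

variable {Ω : Type*} [MeasurableSpace Ω] {P : Measure Ω} [IsProbabilityMeasure P] {n d : ℕ}
  {A : Matrix (Fin n) (Fin n) ℝ} {B : Matrix (Fin n) (Fin d) ℝ}
  {S : Matrix (Fin n) (Fin n) ℝ} {R : Matrix (Fin d) (Fin d) ℝ} {Dω : Matrix (Fin n) (Fin n) ℝ}
  {σ : ℝ} {η : ℕ → Ω → EuclideanSpace ℝ (Fin d)} {w : ℕ → Ω → EuclideanSpace ℝ (Fin n)}
  {K : Matrix (Fin d) (Fin n) ℝ}

namespace IsNoise

theorem past_le (h : IsNoise P σ Dω η w) (t : ℕ) : past η w t ≤ ‹MeasurableSpace Ω› :=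
  iSup₂_le fun s _ => ((h.measurable_η s).prodMk (h.measurable_w s)).comap_le

theorem present_le (h : IsNoise P σ Dω η w) (t : ℕ) : present η w t ≤ ‹MeasurableSpace Ω› :=
  ((h.measurable_η t).prodMk (h.measurable_w t)).comap_le

theorem indep_past_present (h : IsNoise P σ Dω η w) (t : ℕ) :
    Indep (past η w t) (present η w t) P := by
  have h1 := indep_iSup_of_disjoint
    (fun s => ((h.measurable_η s).prodMk (h.measurable_w s)).comap_le) h.indep_time.iIndep
    (S := Set.Iio t) (T := {t}) (by simp)
  simpa [past, present] using h1

/-- This takes the place of conditional expectation throughout. The product formula for independent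
functions needs only measurability, hence no integrability hypotheses. -/
theorem integral_mul_of_past (h : IsNoise P σ Dω η w) {t : ℕ} {f g : Ω → ℝ}
    (hf : Measurable[past η w t] f) (hg : Measurable[present η w t] g) :
    ∫ ω, f ω * g ω ∂P = (∫ ω, f ω ∂P) * ∫ ω, g ω ∂P := by
  have hind : IndepFun f g P := by
    rw [IndepFun_iff_Indep]
    exact indep_of_indep_of_le (h.indep_past_present t) hf.comap_le hg.comap_le
  exact hind.integral_fun_mul_eq_mul_integral
    (hf.mono (h.past_le t) le_rfl).aestronglyMeasurable
    (hg.mono (h.present_le t) le_rfl).aestronglyMeasurable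

theorem gaussian_η (h : IsNoise P σ Dω η w) (t : ℕ) : HasGaussianLaw (η t) P :=
  (h.law_η t).hasGaussianLaw

theorem gaussian_w (h : IsNoise P σ Dω η w) (t : ℕ) : HasGaussianLaw (w t) P :=
  (h.law_w t).hasGaussianLaw

theorem gaussian_η_apply (h : IsNoise P σ Dω η w) (t : ℕ) (i : Fin d) :
    HasGaussianLaw (fun ω => (η t ω).ofLp i) P :=
  (h.gaussian_η t).map_fun (EuclideanSpace.proj i)

theorem gaussian_w_apply (h : IsNoise P σ Dω η w) (t : ℕ) (i : Fin n) :
    HasGaussianLaw (fun ω => (w t ω).ofLp i) P :=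
  (h.gaussian_w t).map_fun (EuclideanSpace.proj i)

/-- Independence makes `(η t, w t)` jointly Gaussian, and each coordinate of the effective noise is
a continuous linear functional of the pair. -/
theorem gaussian_noise (h : IsNoise P σ Dω η w) (t : ℕ) (a : Fin n) :
    HasGaussianLaw (fun ω => noise B η w t ω a) P := by
  have h1 := (h.indep_pair t).hasGaussianLaw (h.gaussian_η t) (h.gaussian_w t)
  have h2 := h1.map_fun ((∑ i, B a i • (EuclideanSpace.proj (𝕜 := ℝ) i :
      EuclideanSpace ℝ (Fin d) →L[ℝ] ℝ)).coprod (EuclideanSpace.proj (𝕜 := ℝ) a))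
  have h3 : (fun ω => noise B η w t ω a) = fun ω => ((∑ i, B a i • (EuclideanSpace.proj (𝕜 := ℝ) i :
      EuclideanSpace ℝ (Fin d) →L[ℝ] ℝ)).coprod (EuclideanSpace.proj (𝕜 := ℝ) a))
        (η t ω, w t ω) := by
    ext ω
    simp [noise, Matrix.mulVec, dotProduct]
  rw [h3]
  exact h2

theorem moments_η (h : IsNoise P σ Dω η w) (t : ℕ) (i : Fin d) :
    HasAllMoments (fun ω => (η t ω).ofLp i) P := fun _ hp => (h.gaussian_η_apply t i).memLp hp

theorem moments_w (h : IsNoise P σ Dω η w) (t : ℕ) (i : Fin n) :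
    HasAllMoments (fun ω => (w t ω).ofLp i) P := fun _ hp => (h.gaussian_w_apply t i).memLp hp

theorem moments_noise (h : IsNoise P σ Dω η w) (t : ℕ) (a : Fin n) :
    HasAllMoments (fun ω => noise B η w t ω a) P := fun _ hp => (h.gaussian_noise t a).memLp hp

theorem moments_state (h : IsNoise P σ Dω η w) (t : ℕ) (a : Fin n) :
    HasAllMoments (fun ω => state A B η w K t ω a) P := by
  induction t generalizing a with
  | zero => exact HasAllMoments.const 0
  | succ t ih =>
    simp only [state_succ, Pi.add_apply]
    exact (HasAllMoments.mulVec _ ih a).add (h.moments_noise t a)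

theorem moments_cost (h : IsNoise P σ Dω η w) (t : ℕ) :
    HasAllMoments (cost A B S R η w K t) P := by
  have hx := h.moments_state (A := A) (B := B) (K := K) t
  have hu : ∀ i, HasAllMoments (fun ω => control A B η w K t ω i) P := fun i =>
    (HasAllMoments.mulVec K hx i).add (h.moments_η t i)
  exact (HasAllMoments.dotProduct hx (HasAllMoments.mulVec S hx)).add
    (HasAllMoments.dotProduct hu (HasAllMoments.mulVec R hu))

theorem moments_score (h : IsNoise P σ Dω η w) (t : ℕ) (i : Fin d) (j : Fin n) :
    HasAllMoments (fun ω => score A B η w K t ω i j) P := by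
  simp only [score_apply]
  exact (h.moments_η t i).mul (h.moments_state t j)

theorem integral_multivariateGaussian_apply {m : ℕ} (V : Matrix (Fin m) (Fin m) ℝ) (i : Fin m) :
    ∫ x : EuclideanSpace ℝ (Fin m), x.ofLp i ∂(multivariateGaussian 0 V) = 0 := by
  have h1 := (EuclideanSpace.proj (𝕜 := ℝ) i : EuclideanSpace ℝ (Fin m) →L[ℝ] ℝ).integral_comp_comm
    (IsGaussian.integrable_fun_id (μ := multivariateGaussian (0 : EuclideanSpace ℝ (Fin m)) V))
  simpa using h1

theorem integral_η (h : IsNoise P σ Dω η w) (t : ℕ) (i : Fin d) :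
    ∫ ω, (η t ω).ofLp i ∂P = 0 := by
  rw [← integral_multivariateGaussian_apply (σ ^ 2 • (1 : Matrix (Fin d) (Fin d) ℝ)) i]
  exact (h.law_η t).integral_comp (f := fun x => x.ofLp i) (by fun_prop)

theorem integral_w (h : IsNoise P σ Dω η w) (t : ℕ) (i : Fin n) :
    ∫ ω, (w t ω).ofLp i ∂P = 0 := by
  rw [← integral_multivariateGaussian_apply Dω i]
  exact (h.law_w t).integral_comp (f := fun x => x.ofLp i) (by fun_prop)

theorem integral_noise (h : IsNoise P σ Dω η w) (t : ℕ) (a : Fin n) :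
    ∫ ω, noise B η w t ω a ∂P = 0 := by
  simp only [noise, Pi.add_apply, Matrix.mulVec, dotProduct]
  rw [integral_add, integral_finsetSum]
  · simp [integral_const_mul, h.integral_η, h.integral_w]
  · exact fun i _ => ((h.moments_η t i).const_mul _).integrable
  · exact integrable_finsetSum _ fun i _ => ((h.moments_η t i).const_mul _).integrable
  · exact (h.moments_w t a).integrable

theorem integral_η_mul_η (h : IsNoise P σ Dω η w) (t : ℕ) (i j : Fin d) :
    ∫ ω, (η t ω).ofLp i * (η t ω).ofLp j ∂P = if i = j then σ ^ 2 else 0 := by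
  have hS : (σ ^ 2 • (1 : Matrix (Fin d) (Fin d) ℝ)).PosSemidef :=
    Matrix.PosSemidef.one.smul (sq_nonneg σ)
  have h1 := covariance_eval_multivariateGaussian (μ := 0) hS i j
  rw [← (h.law_η t).covariance_fun_comp (by fun_prop) (by fun_prop),
    covariance_eq_sub ((h.moments_η t i) 2 (by simp)) ((h.moments_η t j) 2 (by simp)),
    h.integral_η, zero_mul, sub_zero] at h1
  simpa [Matrix.one_apply] using h1

/-- Only the part `B η_t` correlates with `η_t`. This is where the factor `σ²` and the matrix `B`
enter the gradient. -/
theorem integral_η_mul_noise (h : IsNoise P σ Dω η w) (t : ℕ) (i : Fin d) (a : Fin n) :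
    ∫ ω, (η t ω).ofLp i * noise B η w t ω a ∂P = σ ^ 2 * B a i := by
  have hηw : ∫ ω, (η t ω).ofLp i * (w t ω).ofLp a ∂P = 0 := by
    have hind : IndepFun (fun ω => (η t ω).ofLp i) (fun ω => (w t ω).ofLp a) P :=
      (h.indep_pair t).comp (φ := fun x : EuclideanSpace ℝ (Fin d) => x.ofLp i)
        (ψ := fun x : EuclideanSpace ℝ (Fin n) => x.ofLp a) (by fun_prop) (by fun_prop)
    rw [hind.integral_fun_mul_eq_mul_integral (h.moments_η t i).integrable.aestronglyMeasurable
      (h.moments_w t a).integrable.aestronglyMeasurable, h.integral_η, zero_mul]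
  have h1 : ∀ ω, (η t ω).ofLp i * noise B η w t ω a =
      ∑ l, B a l * ((η t ω).ofLp i * (η t ω).ofLp l) + (η t ω).ofLp i * (w t ω).ofLp a := by
    intro ω
    simp only [noise, Pi.add_apply, Matrix.mulVec, dotProduct, mul_add, Finset.mul_sum]
    congr 1
    exact Finset.sum_congr rfl fun l _ => by ring
  have h2 : ∀ l, Integrable (fun ω => B a l * ((η t ω).ofLp i * (η t ω).ofLp l)) P := fun l =>
    (((h.moments_η t i).mul (h.moments_η t l)).const_mul _).integrable
  simp only [h1]
  rw [integral_add (integrable_finsetSum _ fun l _ => h2 l)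
    ((h.moments_η t i).mul (h.moments_w t a)).integrable, integral_finsetSum _ fun l _ => h2 l,
    hηw]
  simp [integral_const_mul, h.integral_η_mul_η, mul_comm]

theorem map_pair_eq (h : IsNoise P σ Dω η w) (t : ℕ) :
    P.map (fun ω => (η t ω, w t ω)) = (multivariateGaussian 0 (σ ^ 2 • 1)).prod
      (multivariateGaussian 0 Dω) := by
  rw [(indepFun_iff_map_prod_eq_prod_map_map (h.measurable_η t).aemeasurable
    (h.measurable_w t).aemeasurable).1 (h.indep_pair t), (h.law_η t).map_eq, (h.law_w t).map_eq]

/-- `effCov` is taken at time `0`; the pair `(η t, w t)` has the same law at all times. -/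
theorem integral_noise_mul_noise (h : IsNoise P σ Dω η w) (t : ℕ) (a b : Fin n) :
    ∫ ω, noise B η w t ω a * noise B η w t ω b ∂P = effCov P B η w a b := by
  have hF : Measurable fun p : EuclideanSpace ℝ (Fin d) × EuclideanSpace ℝ (Fin n) =>
      (B *ᵥ p.1.ofLp + p.2.ofLp) a * (B *ᵥ p.1.ofLp + p.2.ofLp) b := by
    simp only [Pi.add_apply, Matrix.mulVec, dotProduct]
    fun_prop
  have key : ∀ s, ∫ ω, noise B η w s ω a * noise B η w s ω b ∂P =
      ∫ p : EuclideanSpace ℝ (Fin d) × EuclideanSpace ℝ (Fin n),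
        (B *ᵥ p.1.ofLp + p.2.ofLp) a * (B *ᵥ p.1.ofLp + p.2.ofLp) b
          ∂((multivariateGaussian 0 (σ ^ 2 • 1)).prod (multivariateGaussian 0 Dω)) := by
    intro s
    rw [← h.map_pair_eq s, integral_map
      ((h.measurable_η s).prodMk (h.measurable_w s)).aemeasurable hF.aestronglyMeasurable]
    rfl
  rw [key t, ← key 0]
  rfl

end IsNoise

end Noise

end LQR

namespace LQR

set_option linter.unusedSectionVars false

/-! ### Score-weighted covariances and the policy gradient identity -/

section Recursion

variable {Ω : Type*} [MeasurableSpace Ω] {P : Measure Ω} [IsProbabilityMeasure P] {n d : ℕ}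
  {A : Matrix (Fin n) (Fin n) ℝ} {B : Matrix (Fin n) (Fin d) ℝ}
  {S : Matrix (Fin n) (Fin n) ℝ} {R : Matrix (Fin d) (Fin d) ℝ} {Dω : Matrix (Fin n) (Fin n) ℝ}
  {σ : ℝ} {η : ℕ → Ω → EuclideanSpace ℝ (Fin d)} {w : ℕ → Ω → EuclideanSpace ℝ (Fin n)}
  {K : Matrix (Fin d) (Fin n) ℝ}

namespace IsNoise

theorem measurable_past_mulVec_state {m : ℕ} (M : Matrix (Fin m) (Fin n) ℝ) {s t : ℕ} (h : s ≤ t)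
    (a : Fin m) : Measurable[past η w t] fun ω => (M *ᵥ state A B η w K s ω) a :=
  (measurable_pi_apply a).comp (measurable_mulVec (m := past η w t) M (measurable_past_state h))

theorem measurable_past_state_apply {s t : ℕ} (h : s ≤ t) (a : Fin n) :
    Measurable[past η w t] fun ω => state A B η w K s ω a :=
  (measurable_pi_apply a).comp (measurable_past_state h)

theorem integral_state (h : IsNoise P σ Dω η w) (t : ℕ) (a : Fin n) :
    ∫ ω, state A B η w K t ω a ∂P = 0 := by
  induction t generalizing a with
  | zero => simp [state]
  | succ t ih =>
    simp only [state_succ, Pi.add_apply]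
    rw [integral_add (HasAllMoments.mulVec _ (h.moments_state t) a).integrable
      (h.moments_noise t a).integrable, h.integral_noise]
    simp only [Matrix.mulVec, dotProduct]
    rw [integral_finsetSum _ fun i _ => ((h.moments_state t i).const_mul _).integrable]
    simp [integral_const_mul, ih]

/-- No measurability is imposed on the weight, because two cases are needed: a weight from the past
kills the cross terms, whereas the score at time `t` makes them the main contribution. -/
theorem weightedCov_state_succ_apply (h : IsNoise P σ Dω η w) {φ : Ω → ℝ}
    (hφ : HasAllMoments φ P) (t : ℕ) (a b : Fin n) :
    weightedCov P φ (state A B η w K (t + 1)) a b =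
      ((A + B * K) * weightedCov P φ (state A B η w K t) * (A + B * K)ᵀ) a b +
      (∫ ω, φ ω * (((A + B * K) *ᵥ state A B η w K t ω) a * noise B η w t ω b) ∂P +
        ∫ ω, φ ω * (((A + B * K) *ᵥ state A B η w K t ω) b * noise B η w t ω a) ∂P) +
      ∫ ω, φ ω * (noise B η w t ω a * noise B η w t ω b) ∂P := by
  have hx := h.moments_state (A := A) (B := B) (K := K) t
  have hy := fun i => HasAllMoments.mulVec (A + B * K) hx i
  have hv := h.moments_noise (B := B) t
  rw [← weightedCov_mulVec hφ hx]
  simp only [weightedCov, Matrix.of_apply]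
  rw [← integral_add (hφ.mul ((hy a).mul (hv b))).integrable
      (hφ.mul ((hy b).mul (hv a))).integrable,
    ← integral_add (hφ.mul ((hy a).mul (hy b))).integrable
      ((hφ.mul ((hy a).mul (hv b))).add (hφ.mul ((hy b).mul (hv a)))).integrable,
    ← integral_add ((hφ.mul ((hy a).mul (hy b))).add
      ((hφ.mul ((hy a).mul (hv b))).add (hφ.mul ((hy b).mul (hv a))))).integrable
      (hφ.mul ((hv a).mul (hv b))).integrable]
  refine integral_congr_ae (.of_forall fun ω => ?_)
  simp only [state_succ, Pi.add_apply]
  ring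

/-- Conditioning on the past: the weighted second moments follow the Lyapunov recursion. -/
theorem weightedCov_state_succ (h : IsNoise P σ Dω η w) {φ : Ω → ℝ} (hφ : HasAllMoments φ P)
    {t : ℕ} (hm : Measurable[past η w t] φ) :
    weightedCov P φ (state A B η w K (t + 1)) =
      (A + B * K) * weightedCov P φ (state A B η w K t) * (A + B * K)ᵀ +
        (∫ ω, φ ω ∂P) • effCov P B η w := by
  ext a b
  have h0 : ∀ a b, ∫ ω, φ ω * (((A + B * K) *ᵥ state A B η w K t ω) a * noise B η w t ω b) ∂P
      = 0 := by
    intro a b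
    simp only [← mul_assoc]
    rw [h.integral_mul_of_past (hm.fun_mul (measurable_past_mulVec_state _ le_rfl a))
      (measurable_present_noise t b), h.integral_noise, mul_zero]
  rw [h.weightedCov_state_succ_apply hφ, h0, h0,
    h.integral_mul_of_past hm ((measurable_present_noise t a).fun_mul (measurable_present_noise t b)),
    h.integral_noise_mul_noise]
  simp

theorem weightedCov_one_state (h : IsNoise P σ Dω η w) (t : ℕ) :
    weightedCov P (fun _ => 1) (state A B η w K t) =
      covSeq (A + B * K) (effCov P B η w) t := by
  induction t with
  | zero => ext a b; simp [weightedCov, state, covSeq]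
  | succ t ih =>
    rw [h.weightedCov_state_succ (HasAllMoments.const 1) measurable_const, ih]
    simp [covSeq]

theorem integral_state_mul_state (h : IsNoise P σ Dω η w) (t : ℕ) (a b : Fin n) :
    ∫ ω, state A B η w K t ω a * state A B η w K t ω b ∂P =
      covSeq (A + B * K) (effCov P B η w) t a b := by
  rw [← h.weightedCov_one_state]
  simp [weightedCov]

theorem integral_state_quad (h : IsNoise P σ Dω η w) (t : ℕ) (Q : Matrix (Fin n) (Fin n) ℝ) :
    ∫ ω, state A B η w K t ω ⬝ᵥ Q *ᵥ state A B η w K t ω ∂P =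
      (Q * covSeq (A + B * K) (effCov P B η w) t).trace := by
  rw [← h.weightedCov_one_state, ← integral_mul_quad (HasAllMoments.const 1) (h.moments_state t)]
  simp

theorem integral_state_mul_mulVec_state (h : IsNoise P σ Dω η w) (t : ℕ) {m : ℕ}
    (M : Matrix (Fin m) (Fin n) ℝ) (j : Fin n) (a : Fin m) :
    ∫ ω, state A B η w K t ω j * (M *ᵥ state A B η w K t ω) a ∂P =
      ∑ l, M a l * covSeq (A + B * K) (effCov P B η w) t j l := by
  have h1 : ∀ ω, state A B η w K t ω j * (M *ᵥ state A B η w K t ω) a =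
      ∑ l, M a l * (state A B η w K t ω j * state A B η w K t ω l) := by
    intro ω
    simp only [Matrix.mulVec, dotProduct, Finset.mul_sum]
    exact Finset.sum_congr rfl fun l _ => by ring
  simp only [h1]
  rw [integral_finsetSum _ fun l _ =>
    (((h.moments_state t j).mul (h.moments_state t l)).const_mul _).integrable]
  simp [integral_const_mul, h.integral_state_mul_state]

theorem covSeq_effCov_comm (h : IsNoise P σ Dω η w) (t : ℕ) (a b : Fin n) :
    covSeq (A + B * K) (effCov P B η w) t a b = covSeq (A + B * K) (effCov P B η w) t b a := by
  rw [← h.integral_state_mul_state, ← h.integral_state_mul_state]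
  simp only [mul_comm]

theorem measurable_past_score {s t : ℕ} (hst : s < t) (i : Fin d) (j : Fin n) :
    Measurable[past η w t] fun ω => score A B η w K s ω i j := by
  simp only [score_apply]
  exact (measurable_past_η hst i).mul (measurable_past_state_apply hst.le j)

theorem integral_score (h : IsNoise P σ Dω η w) (t : ℕ) (i : Fin d) (j : Fin n) :
    ∫ ω, score A B η w K t ω i j ∂P = 0 := by
  simp only [score_apply]
  simp only [mul_comm ((η t _).ofLp i)]
  rw [h.integral_mul_of_past (measurable_past_state_apply le_rfl j) (measurable_present_η t i),
    h.integral_η, mul_zero]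

theorem weightedCov_score_self (h : IsNoise P σ Dω η w) (t : ℕ) (i : Fin d) (j : Fin n) :
    weightedCov P (fun ω => score A B η w K t ω i j) (state A B η w K t) = 0 := by
  ext a b
  simp only [weightedCov, Matrix.of_apply, Matrix.zero_apply, score_apply]
  have h1 : ∀ ω, (η t ω).ofLp i * state A B η w K t ω j *
      (state A B η w K t ω a * state A B η w K t ω b) =
      (state A B η w K t ω j * (state A B η w K t ω a * state A B η w K t ω b)) *
        (η t ω).ofLp i := fun ω => by ring
  simp only [h1]
  rw [h.integral_mul_of_past ((measurable_past_state_apply le_rfl j).fun_mul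
    ((measurable_past_state_apply le_rfl a).fun_mul (measurable_past_state_apply le_rfl b)))
    (measurable_present_η t i), h.integral_η, mul_zero]

/-- The single step in which the score meets its own noise. The cross terms survive through `E[η_t
v_tᵀ]`; the term quadratic in the noise contains the factor `E[x_t] = 0`. The result is `σ²` times
the forcing term of `covDer` in the direction `B * Matrix.single i j 1`. -/
theorem weightedCov_score_succ_self (h : IsNoise P σ Dω η w) (t : ℕ) (i : Fin d) (j : Fin n) :
    weightedCov P (fun ω => score A B η w K t ω i j) (state A B η w K (t + 1)) =
      σ ^ 2 • (B * Matrix.single i j (1 : ℝ) * covSeq (A + B * K) (effCov P B η w) t * (A + B * K)ᵀ +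
        (A + B * K) * covSeq (A + B * K) (effCov P B η w) t * (B * Matrix.single i j (1 : ℝ))ᵀ) := by
  ext a b
  have hcross : ∀ a b, ∫ ω, score A B η w K t ω i j *
      (((A + B * K) *ᵥ state A B η w K t ω) a * noise B η w t ω b) ∂P =
      (∑ l, (A + B * K) a l * covSeq (A + B * K) (effCov P B η w) t j l) * (σ ^ 2 * B b i) := by
    intro a b
    have h1 : ∀ ω, score A B η w K t ω i j *
        (((A + B * K) *ᵥ state A B η w K t ω) a * noise B η w t ω b) =
        (state A B η w K t ω j * ((A + B * K) *ᵥ state A B η w K t ω) a) *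
          ((η t ω).ofLp i * noise B η w t ω b) := fun ω => by rw [score_apply]; ring
    simp only [h1]
    rw [h.integral_mul_of_past ((measurable_past_state_apply le_rfl j).fun_mul
      (measurable_past_mulVec_state _ le_rfl a))
      ((measurable_present_η t i).fun_mul (measurable_present_noise t b)),
      h.integral_state_mul_mulVec_state, h.integral_η_mul_noise]
  have hnoise : ∫ ω, score A B η w K t ω i j * (noise B η w t ω a * noise B η w t ω b) ∂P = 0 := by
    have h1 : ∀ ω, score A B η w K t ω i j * (noise B η w t ω a * noise B η w t ω b) =
        state A B η w K t ω j * ((η t ω).ofLp i * (noise B η w t ω a * noise B η w t ω b)) :=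
      fun ω => by rw [score_apply]; ring
    simp only [h1]
    rw [h.integral_mul_of_past (measurable_past_state_apply le_rfl j)
      ((measurable_present_η t i).fun_mul
        ((measurable_present_noise t a).fun_mul (measurable_present_noise t b))),
      h.integral_state, zero_mul]
  rw [h.weightedCov_state_succ_apply (h.moments_score t i j), hcross, hcross, hnoise,
    h.weightedCov_score_self]
  -- This product has column `i` of `B` as its column `j` and zeros elsewhere; together with the
  -- symmetry of the covariance this matches the two index patterns.
  have e1 : ∀ a c, (B * Matrix.single i j (1 : ℝ)) a c = if c = j then B a i else 0 := by
    intro a c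
    rw [Matrix.mul_apply]
    simp [Matrix.single_apply, ite_and, eq_comm]
  have hX := h.covSeq_effCov_comm (A := A) (B := B) (K := K) t j
  clear hcross hnoise
  generalize covSeq (A + B * K) (effCov P B η w) t = X at hX ⊢
  generalize A + B * K = M
  simp only [Matrix.mul_zero, Matrix.zero_mul, Matrix.zero_apply, Matrix.smul_apply,
    Matrix.add_apply, Matrix.mul_assoc (B * Matrix.single i j (1 : ℝ)), smul_eq_mul]
  rw [Matrix.mul_apply (M := B * Matrix.single i j (1 : ℝ)), Matrix.mul_apply (M := M * X)]
  simp only [Matrix.transpose_apply, e1, ite_mul, zero_mul, mul_ite, mul_zero,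
    Finset.sum_ite_eq', Finset.mem_univ, if_true]
  simp only [Matrix.mul_apply (N := Mᵀ), Matrix.mul_apply (M := M), Matrix.transpose_apply, hX,
    mul_comm (X _ _)]
  ring

/-- The accumulated score-weighted second moments are the derivative of the state covariance. -/
theorem sum_weightedCov_score (h : IsNoise P σ Dω η w) (k : ℕ) (i : Fin d) (j : Fin n) :
    ∑ t ∈ Finset.range k,
        weightedCov P (fun ω => score A B η w K t ω i j) (state A B η w K k) =
      σ ^ 2 • covDer (A + B * K) (effCov P B η w) (B * Matrix.single i j (1 : ℝ)) k := by
  induction k with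
  | zero => simp [covDer]
  | succ k ih =>
    rw [Finset.sum_range_succ, h.weightedCov_score_succ_self]
    -- Earlier scores are measurable with respect to the past of `k` and have mean zero, so the
    -- forcing by `effCov` disappears.
    have h1 : ∀ t ∈ Finset.range k,
        weightedCov P (fun ω => score A B η w K t ω i j) (state A B η w K (k + 1)) =
        (A + B * K) * weightedCov P (fun ω => score A B η w K t ω i j) (state A B η w K k) *
          (A + B * K)ᵀ := by
      intro t ht
      rw [h.weightedCov_state_succ (h.moments_score t i j)
        (measurable_past_score (Finset.mem_range.1 ht) i j), h.integral_score, zero_smul, add_zero]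
    rw [Finset.sum_congr rfl h1, ← Finset.sum_mul, ← Finset.mul_sum, ih, covDer]
    simp only [Matrix.mul_smul, Matrix.smul_mul, smul_add]

theorem integral_mul_cost (h : IsNoise P σ Dω η w) {φ : Ω → ℝ} (hφ : HasAllMoments φ P) (k : ℕ) :
    ∫ ω, φ ω * cost A B S R η w K k ω ∂P =
      ((S + Kᵀ * R * K) * weightedCov P φ (state A B η w K k)).trace +
      (∑ a, ∑ b, (R * K) a b * ∫ ω, φ ω * ((η k ω).ofLp a * state A B η w K k ω b) ∂P +
        ∑ b, ∑ a, (Kᵀ * R) b a * ∫ ω, φ ω * (state A B η w K k ω b * (η k ω).ofLp a) ∂P) +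
      ∑ a, ∑ b, R a b * ∫ ω, φ ω * ((η k ω).ofLp a * (η k ω).ofLp b) ∂P := by
  have hx := h.moments_state (A := A) (B := B) (K := K) k
  have hη := h.moments_η k
  rw [← integral_mul_quad hφ hx, ← integral_mul_bilin hφ hη hx, ← integral_mul_bilin hφ hx hη,
    ← integral_mul_bilin hφ hη hη]
  have m1 := hφ.mul (HasAllMoments.dotProduct hx (HasAllMoments.mulVec (S + Kᵀ * R * K) hx))
  have m2 := hφ.mul (HasAllMoments.dotProduct hη (HasAllMoments.mulVec (R * K) hx))
  have m3 := hφ.mul (HasAllMoments.dotProduct hx (HasAllMoments.mulVec (Kᵀ * R) hη))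
  have m4 := hφ.mul (HasAllMoments.dotProduct hη (HasAllMoments.mulVec R hη))
  rw [← integral_add m2.integrable m3.integrable,
    ← integral_add m1.integrable (m2.add m3).integrable,
    ← integral_add (m1.add (m2.add m3)).integrable m4.integrable]
  refine integral_congr_ae (.of_forall fun ω => ?_)
  simp only [cost_eq]
  ring

/-- The score is known before time `k`: terms linear in `η_k` vanish by `E[η_k] = 0`, and the
quadratic one because the score has mean zero. -/
theorem integral_score_mul_cost_of_lt (h : IsNoise P σ Dω η w) {t k : ℕ} (htk : t < k)
    (i : Fin d) (j : Fin n) :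
    ∫ ω, score A B η w K t ω i j * cost A B S R η w K k ω ∂P =
      ((S + Kᵀ * R * K) *
        weightedCov P (fun ω => score A B η w K t ω i j) (state A B η w K k)).trace := by
  have hm : Measurable[past η w k] fun ω => score A B η w K t ω i j :=
    measurable_past_score htk i j
  have e1 : ∀ a b, ∫ ω, score A B η w K t ω i j *
      (state A B η w K k ω b * (η k ω).ofLp a) ∂P = 0 := by
    intro a b
    simp only [← mul_assoc]
    rw [h.integral_mul_of_past (hm.fun_mul (measurable_past_state_apply le_rfl b))
      (measurable_present_η k a), h.integral_η, mul_zero]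
  have e2 : ∀ a b, ∫ ω, score A B η w K t ω i j *
      ((η k ω).ofLp a * state A B η w K k ω b) ∂P = 0 := by
    intro a b
    rw [← e1 a b]
    simp only [mul_comm ((η k _).ofLp a)]
  have e3 : ∀ a b, ∫ ω, score A B η w K t ω i j * ((η k ω).ofLp a * (η k ω).ofLp b) ∂P = 0 := by
    intro a b
    rw [h.integral_mul_of_past hm ((measurable_present_η k a).fun_mul (measurable_present_η k b)),
      h.integral_score, zero_mul]
  rw [h.integral_mul_cost (h.moments_score t i j)]
  simp [e1, e2, e3]

/-- Here the score contains `η_k`, so only the terms of the cost linear in `η_k` contribute. The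
cubic noise term drops because it is multiplied by `E[x_k] = 0`. -/
theorem integral_score_mul_cost_self (h : IsNoise P σ Dω η w) (k : ℕ) (i : Fin d) (j : Fin n) :
    ∫ ω, score A B η w K k ω i j * cost A B S R η w K k ω ∂P =
      σ ^ 2 * (((Matrix.single i j (1 : ℝ))ᵀ * R * K + Kᵀ * R * Matrix.single i j (1 : ℝ)) *
        covSeq (A + B * K) (effCov P B η w) k).trace := by
  have e1 : ∀ a b, ∫ ω, score A B η w K k ω i j *
      (state A B η w K k ω b * (η k ω).ofLp a) ∂P =
      covSeq (A + B * K) (effCov P B η w) k j b * (if i = a then σ ^ 2 else 0) := by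
    intro a b
    have h1 : ∀ ω, score A B η w K k ω i j * (state A B η w K k ω b * (η k ω).ofLp a) =
        (state A B η w K k ω j * state A B η w K k ω b) * ((η k ω).ofLp i * (η k ω).ofLp a) :=
      fun ω => by rw [score_apply]; ring
    simp only [h1]
    rw [h.integral_mul_of_past ((measurable_past_state_apply le_rfl j).fun_mul
      (measurable_past_state_apply le_rfl b))
      ((measurable_present_η k i).fun_mul (measurable_present_η k a)), h.integral_state_mul_state,
      h.integral_η_mul_η]
  have e2 : ∀ a b, ∫ ω, score A B η w K k ω i j *
      ((η k ω).ofLp a * state A B η w K k ω b) ∂P =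
      covSeq (A + B * K) (effCov P B η w) k j b * (if i = a then σ ^ 2 else 0) := by
    intro a b
    rw [← e1 a b]
    simp only [mul_comm ((η k _).ofLp a)]
  have e3 : ∀ a b, ∫ ω, score A B η w K k ω i j * ((η k ω).ofLp a * (η k ω).ofLp b) ∂P = 0 := by
    intro a b
    have h1 : ∀ ω, score A B η w K k ω i j * ((η k ω).ofLp a * (η k ω).ofLp b) =
        state A B η w K k ω j * ((η k ω).ofLp i * ((η k ω).ofLp a * (η k ω).ofLp b)) :=
      fun ω => by rw [score_apply]; ring
    simp only [h1]
    rw [h.integral_mul_of_past (measurable_past_state_apply le_rfl j)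
      ((measurable_present_η k i).fun_mul ((measurable_present_η k a).fun_mul (measurable_present_η k b))),
      h.integral_state, zero_mul]
  rw [h.integral_mul_cost (h.moments_score k i j), h.weightedCov_score_self]
  simp only [e1, e2, e3, Matrix.trace_zero, zero_add, mul_zero,
    Finset.sum_const_zero, add_zero]
  have t1 : ((Matrix.single i j (1 : ℝ))ᵀ * R * K *
      covSeq (A + B * K) (effCov P B η w) k).trace =
      ∑ b, (R * K) i b * covSeq (A + B * K) (effCov P B η w) k j b := by
    rw [Matrix.mul_assoc, Matrix.mul_assoc, Matrix.transpose_single, Matrix.trace_single_mul,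
      ← Matrix.mul_assoc]
    simp [Matrix.mul_apply (M := R * K), h.covSeq_effCov_comm k j]
  have t2 : (Kᵀ * R * Matrix.single i j (1 : ℝ) *
      covSeq (A + B * K) (effCov P B η w) k).trace =
      ∑ b, (Kᵀ * R) b i * covSeq (A + B * K) (effCov P B η w) k j b := by
    rw [Matrix.trace_mul_comm, ← Matrix.mul_assoc, Matrix.trace_mul_comm,
      Matrix.trace_single_mul]
    simp [Matrix.mul_apply (N := Kᵀ * R), mul_comm]
  rw [Matrix.add_mul, Matrix.trace_add, t1, t2, mul_add, Finset.mul_sum, Finset.mul_sum]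
  simp only [mul_ite, mul_zero]
  rw [Finset.sum_comm]
  simp only [Finset.sum_ite_eq, Finset.mem_univ, if_true]
  congr 1 <;> exact Finset.sum_congr rfl fun b _ => by ring

/-- The policy gradient identity for the cost at a single time. -/
theorem sum_integral_score_mul_cost (h : IsNoise P σ Dω η w) (k : ℕ) (i : Fin d) (j : Fin n) :
    ∑ t ∈ Finset.range (k + 1), ∫ ω, score A B η w K t ω i j * cost A B S R η w K k ω ∂P =
      σ ^ 2 * costDer A B S R (effCov P B η w) k K (Matrix.single i j (1 : ℝ)) := by
  rw [Finset.sum_range_succ, h.integral_score_mul_cost_self,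
    Finset.sum_congr rfl fun t ht =>
      h.integral_score_mul_cost_of_lt (Finset.mem_range.1 ht) i j,
    ← Matrix.trace_sum, ← Finset.mul_sum, h.sum_weightedCov_score, costDer, Matrix.mul_smul,
    Matrix.trace_smul, smul_eq_mul]
  ring

end IsNoise

end Recursion

end LQR

namespace LQR

set_option linter.unusedSectionVars false

/-! ### Euclidean norms and power inequalities -/

section Euclidean

open scoped Matrix.Norms.L2Operator

/-- The Euclidean norm of a vector. -/
noncomputable def vecNorm {m : ℕ} (x : Fin m → ℝ) : ℝ :=
  ‖(WithLp.toLp 2 x : EuclideanSpace ℝ (Fin m))‖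

variable {m l : ℕ}

theorem vecNorm_nonneg (x : Fin m → ℝ) : 0 ≤ vecNorm x := norm_nonneg _

theorem vecNorm_sq (x : Fin m → ℝ) : vecNorm x ^ 2 = ∑ i, x i ^ 2 := by
  rw [vecNorm, EuclideanSpace.real_norm_sq_eq]

theorem vecNorm_zero : vecNorm (0 : Fin m → ℝ) = 0 := by simp [vecNorm]

theorem vecNorm_add_le (x y : Fin m → ℝ) : vecNorm (x + y) ≤ vecNorm x + vecNorm y := by
  simpa [vecNorm] using norm_add_le (WithLp.toLp 2 x : EuclideanSpace ℝ (Fin m)) (WithLp.toLp 2 y)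

theorem vecNorm_mulVec_le (M : Matrix (Fin l) (Fin m) ℝ) (x : Fin m → ℝ) :
    vecNorm (M *ᵥ x) ≤ ‖M‖ * vecNorm x :=
  Matrix.l2_opNorm_mulVec M (WithLp.toLp 2 x)

theorem abs_dotProduct_le (x y : Fin m → ℝ) : |x ⬝ᵥ y| ≤ vecNorm x * vecNorm y := by
  have h := abs_real_inner_le_norm (WithLp.toLp 2 y : EuclideanSpace ℝ (Fin m)) (WithLp.toLp 2 x)
  rw [EuclideanSpace.inner_toLp_toLp, star_trivial] at h
  rw [mul_comm]
  exact h

theorem abs_quad_le (Q : Matrix (Fin m) (Fin m) ℝ) (x : Fin m → ℝ) :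
    |x ⬝ᵥ Q *ᵥ x| ≤ ‖Q‖ * vecNorm x ^ 2 :=
  calc _ ≤ vecNorm x * vecNorm (Q *ᵥ x) := abs_dotProduct_le _ _
    _ ≤ vecNorm x * (‖Q‖ * vecNorm x) := by
      gcongr
      · exact vecNorm_nonneg x
      · exact vecNorm_mulVec_le Q x
    _ = _ := by ring

theorem sq_apply_le_vecNorm_sq (x : Fin m → ℝ) (i : Fin m) : x i ^ 2 ≤ vecNorm x ^ 2 := by
  rw [vecNorm_sq]
  exact Finset.single_le_sum (f := fun i => x i ^ 2) (fun i _ => sq_nonneg _) (Finset.mem_univ i)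

theorem vecNorm_pow_eight_le (x : Fin m → ℝ) :
    vecNorm x ^ 8 ≤ (m : ℝ) ^ 3 * ∑ i, x i ^ 8 := by
  have h1 : vecNorm x ^ 8 = (∑ i, x i ^ 2) ^ 4 := by rw [← vecNorm_sq]; ring
  have h2 : (∑ i, x i ^ 2) ^ 2 ≤ m * ∑ i, x i ^ 4 := by
    have := sq_sum_le_card_mul_sum_sq (s := Finset.univ) (f := fun i => x i ^ 2)
    simpa [← pow_mul] using this
  have h3 : (∑ i, x i ^ 4) ^ 2 ≤ m * ∑ i, x i ^ 8 := by
    have := sq_sum_le_card_mul_sum_sq (s := Finset.univ) (f := fun i => x i ^ 4)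
    simpa [← pow_mul] using this
  calc vecNorm x ^ 8 = ((∑ i, x i ^ 2) ^ 2) ^ 2 := by rw [h1]; ring
    _ ≤ (m * ∑ i, x i ^ 4) ^ 2 := by
      have : 0 ≤ (∑ i, x i ^ 2) ^ 2 := sq_nonneg _
      gcongr
    _ = (m : ℝ) ^ 2 * (∑ i, x i ^ 4) ^ 2 := by ring
    _ ≤ (m : ℝ) ^ 2 * (m * ∑ i, x i ^ 8) := by gcongr
    _ = _ := by ring

/-- Jensen's inequality for the eighth power with unnormalized weights. -/
theorem sum_mul_pow_eight_le {ι : Type*} (s : Finset ι) {q a : ι → ℝ} {W : ℝ}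
    (hq : ∀ i ∈ s, 0 ≤ q i) (hW : ∑ i ∈ s, q i ≤ W) :
    (∑ i ∈ s, q i * a i) ^ 8 ≤ W ^ 7 * ∑ i ∈ s, q i * a i ^ 8 := by
  have hW0 : 0 ≤ W := (Finset.sum_nonneg hq).trans hW
  -- Cauchy–Schwarz with weights, used for `p = 1, 2, 4`; the three uses contribute `W ^ 4`, `W ^ 2`
  -- and `W`.
  have step : ∀ p : ℕ, (∑ i ∈ s, q i * a i ^ p) ^ 2 ≤ W * ∑ i ∈ s, q i * (a i ^ p) ^ 2 := by
    intro p
    refine (Finset.sum_sq_le_sum_mul_sum_of_sq_le_mul s hq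
      (fun i hi => mul_nonneg (hq i hi) (sq_nonneg (a i ^ p))) fun i _ => le_of_eq (by ring)).trans ?_
    exact mul_le_mul_of_nonneg_right hW
      (Finset.sum_nonneg fun i hi => mul_nonneg (hq i hi) (sq_nonneg _))
  have h1 := step 1
  have h2 := step 2
  have h4 := step 4
  simp only [← pow_mul, Nat.reduceMul, pow_one] at h1 h2 h4
  have n2 : 0 ≤ ∑ i ∈ s, q i * a i ^ 2 :=
    Finset.sum_nonneg fun i hi => mul_nonneg (hq i hi) (sq_nonneg _)
  calc _ = (((∑ i ∈ s, q i * a i) ^ 2) ^ 2) ^ 2 := by ring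
    _ ≤ ((W * ∑ i ∈ s, q i * a i ^ 2) ^ 2) ^ 2 := by gcongr
    _ = W ^ 4 * ((∑ i ∈ s, q i * a i ^ 2) ^ 2) ^ 2 := by ring
    _ ≤ W ^ 4 * (W * ∑ i ∈ s, q i * a i ^ 4) ^ 2 := by gcongr
    _ = W ^ 6 * (∑ i ∈ s, q i * a i ^ 4) ^ 2 := by ring
    _ ≤ W ^ 6 * (W * ∑ i ∈ s, q i * a i ^ 8) := by gcongr
    _ = _ := by ring

end Euclidean

/-! ### Moment bounds uniform in time -/

section MomentBounds

open scoped Matrix.Norms.L2Operator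

variable {Ω : Type*} {n d : ℕ}
  {A : Matrix (Fin n) (Fin n) ℝ} {B : Matrix (Fin n) (Fin d) ℝ}
  {S : Matrix (Fin n) (Fin n) ℝ} {R : Matrix (Fin d) (Fin d) ℝ} {Dω : Matrix (Fin n) (Fin n) ℝ}
  {σ : ℝ} {η : ℕ → Ω → EuclideanSpace ℝ (Fin d)} {w : ℕ → Ω → EuclideanSpace ℝ (Fin n)}
  {K : Matrix (Fin d) (Fin n) ℝ}

theorem vecNorm_state_le {Γ ρ : ℝ} (hM : ∀ k, ‖(A + B * K) ^ k‖ ≤ Γ * ρ ^ k) (t : ℕ) (ω : Ω) :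
    vecNorm (state A B η w K t ω) ≤
      Γ * ∑ s ∈ Finset.range t, ρ ^ s * vecNorm (noise B η w (t - 1 - s) ω) := by
  have key : ∀ t j, vecNorm ((A + B * K) ^ j *ᵥ state A B η w K t ω) ≤
      Γ * ∑ s ∈ Finset.range t, ρ ^ (j + s) * vecNorm (noise B η w (t - 1 - s) ω) := by
    intro t
    induction t with
    | zero => intro j; simp [state, vecNorm_zero]
    | succ t ih =>
      intro j
      rw [state_succ, Matrix.mulVec_add, Matrix.mulVec_mulVec, ← pow_succ, Finset.sum_range_succ',
        mul_add]
      refine (vecNorm_add_le _ _).trans (add_le_add ((ih (j + 1)).trans (le_of_eq ?_)) ?_)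
      · congr 1
        refine Finset.sum_congr rfl fun s _ => ?_
        have hs : t + 1 - 1 - (s + 1) = t - 1 - s := by omega
        rw [add_assoc, add_comm 1 s, hs]
      · refine (vecNorm_mulVec_le _ _).trans ?_
        simp only [add_zero, Nat.add_sub_cancel, Nat.sub_zero, ← mul_assoc]
        exact mul_le_mul_of_nonneg_right (hM j) (vecNorm_nonneg _)
  simpa using key t 0

/-- The eighth moment of a centred real Gaussian of variance `v`. -/
noncomputable def gaussianMoment (v : ℝ) : ℝ := ∫ x, x ^ 8 ∂(gaussianReal 0 v.toNNReal)

theorem gaussianMoment_nonneg (v : ℝ) : 0 ≤ gaussianMoment v :=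
  integral_nonneg fun x => by positivity

variable [MeasurableSpace Ω] {P : Measure Ω} [IsProbabilityMeasure P]

/-- A centred real Gaussian law is determined by its variance. This is why the final constants see
the effective noise only through its covariance. -/
theorem integral_pow_eight_of_gaussian {X : Ω → ℝ} (hX : HasGaussianLaw X P)
    (h0 : ∫ ω, X ω ∂P = 0) : ∫ ω, X ω ^ 8 ∂P = gaussianMoment (∫ ω, X ω * X ω ∂P) := by
  have h1 := hX.map_eq_gaussianReal
  rw [h0, variance_of_integral_eq_zero hX.aemeasurable h0] at h1
  simp only [← pow_two]
  rw [gaussianMoment, ← h1, integral_map hX.aemeasurable (by fun_prop)]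

/-- A bound for the eighth moment of the Euclidean norm of a Gaussian vector with
covariance `D`. -/
noncomputable def vecMoment {m : ℕ} (D : Matrix (Fin m) (Fin m) ℝ) : ℝ :=
  (m : ℝ) ^ 3 * ∑ a, gaussianMoment (D a a)

theorem vecMoment_nonneg {m : ℕ} (D : Matrix (Fin m) (Fin m) ℝ) : 0 ≤ vecMoment D :=
  mul_nonneg (by positivity) (Finset.sum_nonneg fun _ _ => gaussianMoment_nonneg _)

theorem HasAllMoments.vecNorm_sq {m : ℕ} {x : Ω → Fin m → ℝ}
    (hx : ∀ i, HasAllMoments (fun ω => x ω i) P) :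
    HasAllMoments (fun ω => vecNorm (x ω) ^ 2) P := by
  simp only [LQR.vecNorm_sq]
  exact HasAllMoments.sum fun i _ => (hx i).pow 2

theorem HasAllMoments.vecNorm_pow_eight {m : ℕ} {x : Ω → Fin m → ℝ}
    (hx : ∀ i, HasAllMoments (fun ω => x ω i) P) :
    HasAllMoments (fun ω => vecNorm (x ω) ^ 8) P := by
  simpa only [← pow_mul] using (HasAllMoments.vecNorm_sq hx).pow 4

theorem integral_vecNorm_pow_eight_le {m : ℕ} {x : Ω → Fin m → ℝ}
    (hx : ∀ i, HasGaussianLaw (fun ω => x ω i) P) (h0 : ∀ i, ∫ ω, x ω i ∂P = 0)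
    {D : Matrix (Fin m) (Fin m) ℝ} (hD : ∀ i, ∫ ω, x ω i * x ω i ∂P = D i i) :
    ∫ ω, vecNorm (x ω) ^ 8 ∂P ≤ vecMoment D := by
  have hm : ∀ i, HasAllMoments (fun ω => x ω i) P := fun i _ hp => (hx i).memLp hp
  calc _ ≤ ∫ ω, (m : ℝ) ^ 3 * ∑ i, x ω i ^ 8 ∂P :=
        integral_mono (HasAllMoments.vecNorm_pow_eight hm).integrable
          ((HasAllMoments.sum fun i _ => (hm i).pow 8).const_mul _).integrable
          fun ω => vecNorm_pow_eight_le (x ω)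
    _ = _ := by
      rw [integral_const_mul, integral_finsetSum _ fun i _ => ((hm i).pow 8).integrable, vecMoment]
      congr 1
      exact Finset.sum_congr rfl fun i _ => by
        rw [integral_pow_eight_of_gaussian (hx i) (h0 i), hD]

/-- A bound for the eighth moments of the states of a stable system. -/
noncomputable def stateMoment (n : ℕ) (Γ κ : ℝ) (D : Matrix (Fin n) (Fin n) ℝ) : ℝ :=
  Γ ^ 8 * (2 * κ) ^ 8 * vecMoment D

/-- `1 / (1 - ρ) = (1 + ρ) / (1 - ρ ^ 2)`; the constants may depend on `ρ` only through `1 / (1 - ρ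
^ 2)`. -/
theorem geom_sum_le_two_mul {ρ : ℝ} (h0 : 0 ≤ ρ) (h1 : ρ < 1) (t : ℕ) :
    ∑ s ∈ Finset.range t, ρ ^ s ≤ 2 * (1 / (1 - ρ ^ 2)) := by
  calc ∑ s ∈ Finset.range t, ρ ^ s ≤ (1 - ρ)⁻¹ := by
        rw [← tsum_geometric_of_lt_one h0 h1]
        exact (summable_geometric_of_lt_one h0 h1).sum_le_tsum _ fun i _ => by positivity
    _ = (1 + ρ) * (1 / (1 - ρ ^ 2)) := by
        have e1 : 1 - ρ ≠ 0 := by linarith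
        have e2 : 1 + ρ ≠ 0 := by linarith
        have e3 : 1 - ρ ^ 2 = (1 - ρ) * (1 + ρ) := by ring
        rw [e3]; field_simp
    _ ≤ 2 * (1 / (1 - ρ ^ 2)) := by
        have : ρ ^ 2 < 1 := by nlinarith
        have h : 0 ≤ 1 / (1 - ρ ^ 2) := one_div_nonneg.2 (by linarith)
        gcongr; linarith

namespace IsNoise

theorem integral_noise_pow_eight_le (h : IsNoise P σ Dω η w) (t : ℕ) :
    ∫ ω, vecNorm (noise B η w t ω) ^ 8 ∂P ≤ vecMoment (effCov P B η w) :=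
  integral_vecNorm_pow_eight_le (h.gaussian_noise t) (h.integral_noise t) fun i =>
    h.integral_noise_mul_noise t i i

theorem integral_η_pow_eight_le (h : IsNoise P σ Dω η w) (t : ℕ) :
    ∫ ω, vecNorm (η t ω).ofLp ^ 8 ∂P ≤
      vecMoment (σ ^ 2 • (1 : Matrix (Fin d) (Fin d) ℝ)) :=
  integral_vecNorm_pow_eight_le (h.gaussian_η_apply t) (h.integral_η t) fun i => by
    rw [h.integral_η_mul_η]; simp

/-- The state is dominated by a sum of noise norms with weights `ρ ^ s`, of total mass at most `W`.
Jensen costs `W ^ 7` and summing the weights once more costs `W`, so there is no growth in `t`. -/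
theorem integral_state_pow_eight_le (h : IsNoise P σ Dω η w) {Γ ρ : ℝ} (hρ0 : 0 ≤ ρ) (hρ1 : ρ < 1)
    (hM : ∀ k, ‖(A + B * K) ^ k‖ ≤ Γ * ρ ^ k) (t : ℕ) :
    ∫ ω, vecNorm (state A B η w K t ω) ^ 8 ∂P ≤
      stateMoment n Γ (1 / (1 - ρ ^ 2)) (effCov P B η w) := by
  have hΓ : 0 ≤ Γ := by simpa using (norm_nonneg _).trans (hM 0)
  set W := 2 * (1 / (1 - ρ ^ 2)) with hW
  have hW0 : 0 ≤ W := (Finset.sum_nonneg fun s _ => pow_nonneg hρ0 s).trans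
    (geom_sum_le_two_mul hρ0 hρ1 0)
  have hmom := fun s => HasAllMoments.vecNorm_pow_eight (h.moments_noise (B := B) s)
  have hpt : ∀ ω, vecNorm (state A B η w K t ω) ^ 8 ≤ Γ ^ 8 * (W ^ 7 *
      ∑ s ∈ Finset.range t, ρ ^ s * vecNorm (noise B η w (t - 1 - s) ω) ^ 8) := by
    intro ω
    calc _ ≤ (Γ * ∑ s ∈ Finset.range t, ρ ^ s * vecNorm (noise B η w (t - 1 - s) ω)) ^ 8 :=
          pow_le_pow_left₀ (vecNorm_nonneg _) (vecNorm_state_le hM t ω) 8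
      _ = Γ ^ 8 * (∑ s ∈ Finset.range t, ρ ^ s * vecNorm (noise B η w (t - 1 - s) ω)) ^ 8 := by
          ring
      _ ≤ _ := by
          gcongr
          exact sum_mul_pow_eight_le _ (fun s _ => by positivity) (geom_sum_le_two_mul hρ0 hρ1 t)
  have hsum : HasAllMoments (fun ω => ∑ s ∈ Finset.range t,
      ρ ^ s * vecNorm (noise B η w (t - 1 - s) ω) ^ 8) P :=
    HasAllMoments.sum fun s _ => (hmom _).const_mul _
  calc _ ≤ ∫ ω, Γ ^ 8 * (W ^ 7 *
        ∑ s ∈ Finset.range t, ρ ^ s * vecNorm (noise B η w (t - 1 - s) ω) ^ 8) ∂P :=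
        integral_mono (HasAllMoments.vecNorm_pow_eight (h.moments_state t)).integrable
          ((hsum.const_mul _).const_mul _).integrable hpt
    _ = Γ ^ 8 * (W ^ 7 * ∑ s ∈ Finset.range t,
          ρ ^ s * ∫ ω, vecNorm (noise B η w (t - 1 - s) ω) ^ 8 ∂P) := by
        rw [integral_const_mul, integral_const_mul,
          integral_finsetSum _ fun s _ => ((hmom _).const_mul _).integrable]
        simp only [integral_const_mul]
    _ ≤ Γ ^ 8 * (W ^ 7 * ∑ s ∈ Finset.range t, ρ ^ s * vecMoment (effCov P B η w)) := by
        gcongr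
        exact h.integral_noise_pow_eight_le _
    _ ≤ Γ ^ 8 * (W ^ 7 * (W * vecMoment (effCov P B η w))) := by
        rw [← Finset.sum_mul]
        have := vecMoment_nonneg (effCov P B η w)
        gcongr
        exact geom_sum_le_two_mul hρ0 hρ1 t
    _ = _ := by rw [stateMoment]; ring

end IsNoise

theorem abs_cost_le (t : ℕ) (ω : Ω) : |cost A B S R η w K t ω| ≤
    (‖S‖ + 2 * ‖R‖ * ‖K‖ ^ 2) * vecNorm (state A B η w K t ω) ^ 2 +
      2 * ‖R‖ * vecNorm (η t ω).ofLp ^ 2 := by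
  set x := state A B η w K t ω
  set y := (η t ω).ofLp
  have hu : vecNorm (K *ᵥ x + y) ^ 2 ≤ 2 * ‖K‖ ^ 2 * vecNorm x ^ 2 + 2 * vecNorm y ^ 2 :=
    calc _ ≤ (‖K‖ * vecNorm x + vecNorm y) ^ 2 := by
          have := vecNorm_nonneg (K *ᵥ x + y)
          gcongr
          exact (vecNorm_add_le _ _).trans (add_le_add (vecNorm_mulVec_le K x) le_rfl)
      _ ≤ _ := by nlinarith [sq_nonneg (‖K‖ * vecNorm x - vecNorm y)]
  calc _ ≤ ‖S‖ * vecNorm x ^ 2 + ‖R‖ * vecNorm (K *ᵥ x + y) ^ 2 :=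
        (abs_add_le _ _).trans (add_le_add (abs_quad_le S x) (abs_quad_le R _))
    _ ≤ ‖S‖ * vecNorm x ^ 2 + ‖R‖ * (2 * ‖K‖ ^ 2 * vecNorm x ^ 2 + 2 * vecNorm y ^ 2) := by
        gcongr
    _ = _ := by ring

/-- A bound for the second moments of the products of scores and costs in terms of eighth
moments. -/
noncomputable def productBound (s r k mx mη : ℝ) : ℝ :=
  (s + 2 * r * k ^ 2) ^ 2 * ((mη + 3 * mx) / 2) + (2 * r) ^ 2 * ((3 * mη + mx) / 2)

theorem four_mul_le_pow_four (a b c : ℝ) :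
    a * b * c ^ 2 ≤ (a ^ 4 + b ^ 4 + 2 * c ^ 4) / 4 := by
  nlinarith [sq_nonneg (a * b - c ^ 2), sq_nonneg (a ^ 2 - b ^ 2)]

/-- Squared, the product is dominated by terms of degree eight in the norms; the
arithmetic-geometric mean inequality separates the factors, so their dependence does not matter. -/
theorem sq_score_mul_cost_le (t k : ℕ) (i : Fin d) (j : Fin n) (ω : Ω) :
    (score A B η w K t ω i j * cost A B S R η w K k ω) ^ 2 ≤
      (‖S‖ + 2 * ‖R‖ * ‖K‖ ^ 2) ^ 2 * ((vecNorm (η t ω).ofLp ^ 8 +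
        vecNorm (state A B η w K t ω) ^ 8 + 2 * vecNorm (state A B η w K k ω) ^ 8) / 2) +
      (2 * ‖R‖) ^ 2 * ((vecNorm (η t ω).ofLp ^ 8 + vecNorm (state A B η w K t ω) ^ 8 +
        2 * vecNorm (η k ω).ofLp ^ 8) / 2) := by
  set H := vecNorm (η t ω).ofLp ^ 2 with hH
  set N := vecNorm (state A B η w K t ω) ^ 2 with hN
  set N' := vecNorm (state A B η w K k ω) ^ 2 with hN'
  set H' := vecNorm (η k ω).ofLp ^ 2 with hH'
  have e : ∀ x : ℝ, x ^ 8 = (x ^ 2) ^ 4 := fun x => by ring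
  simp only [e, ← hH, ← hN, ← hN', ← hH']
  have hs : score A B η w K t ω i j ^ 2 ≤ H * N := by
    rw [score_apply, mul_pow]
    exact mul_le_mul (sq_apply_le_vecNorm_sq _ i) (sq_apply_le_vecNorm_sq _ j) (sq_nonneg _)
      (sq_nonneg _)
  have hHN : 0 ≤ H * N := mul_nonneg (sq_nonneg _) (sq_nonneg _)
  set α := ‖S‖ + 2 * ‖R‖ * ‖K‖ ^ 2
  set β := 2 * ‖R‖
  have hc : cost A B S R η w K k ω ^ 2 ≤ 2 * α ^ 2 * N' ^ 2 + 2 * β ^ 2 * H' ^ 2 := by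
    rw [← sq_abs]
    calc _ ≤ (α * N' + β * H') ^ 2 := by
          gcongr
          exact abs_cost_le k ω
      _ ≤ _ := by nlinarith [sq_nonneg (α * N' - β * H')]
  calc _ = score A B η w K t ω i j ^ 2 * cost A B S R η w K k ω ^ 2 := by ring
    _ ≤ (H * N) * (2 * α ^ 2 * N' ^ 2 + 2 * β ^ 2 * H' ^ 2) :=
        mul_le_mul hs hc (sq_nonneg _) hHN
    _ = 2 * α ^ 2 * (H * N * N' ^ 2) + 2 * β ^ 2 * (H * N * H' ^ 2) := by ring
    _ ≤ 2 * α ^ 2 * ((H ^ 4 + N ^ 4 + 2 * N' ^ 4) / 4) +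
        2 * β ^ 2 * ((H ^ 4 + N ^ 4 + 2 * H' ^ 4) / 4) := by
        gcongr
        · exact four_mul_le_pow_four _ _ _
        · exact four_mul_le_pow_four _ _ _
    _ = _ := by ring

/-- A bound for the second moments of the products of scores and costs. -/
noncomputable def scoreCostBound (n d : ℕ) (s r k Γ κ : ℝ) (D : Matrix (Fin n) (Fin n) ℝ)
    (σ : ℝ) : ℝ :=
  productBound s r k (stateMoment n Γ κ D) (vecMoment (σ ^ 2 • (1 : Matrix (Fin d) (Fin d) ℝ)))

theorem IsNoise.integral_sq_score_mul_cost_le (h : IsNoise P σ Dω η w) {Γ ρ : ℝ} (hρ0 : 0 ≤ ρ)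
    (hρ1 : ρ < 1) (hM : ∀ k, ‖(A + B * K) ^ k‖ ≤ Γ * ρ ^ k) (t k : ℕ) (i : Fin d) (j : Fin n) :
    ∫ ω, (score A B η w K t ω i j * cost A B S R η w K k ω) ^ 2 ∂P ≤
      scoreCostBound n d ‖S‖ ‖R‖ ‖K‖ Γ (1 / (1 - ρ ^ 2)) (effCov P B η w) σ := by
  have mη := fun t => HasAllMoments.vecNorm_pow_eight (h.moments_η t)
  have mx := fun t =>
    HasAllMoments.vecNorm_pow_eight (h.moments_state (A := A) (B := B) (K := K) t)
  have m1 := ((((mη t).add (mx t)).add ((mx k).const_mul 2)).const_mul (1 / 2)).const_mul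
    ((‖S‖ + 2 * ‖R‖ * ‖K‖ ^ 2) ^ 2)
  have m2 := ((((mη t).add (mx t)).add ((mη k).const_mul 2)).const_mul (1 / 2)).const_mul
    ((2 * ‖R‖) ^ 2)
  have bη := h.integral_η_pow_eight_le
  have bx := h.integral_state_pow_eight_le hρ0 hρ1 hM
  calc _ ≤ ∫ ω, ((‖S‖ + 2 * ‖R‖ * ‖K‖ ^ 2) ^ 2 * (1 / 2 * (vecNorm (η t ω).ofLp ^ 8 +
        vecNorm (state A B η w K t ω) ^ 8 + 2 * vecNorm (state A B η w K k ω) ^ 8)) +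
      (2 * ‖R‖) ^ 2 * (1 / 2 * (vecNorm (η t ω).ofLp ^ 8 + vecNorm (state A B η w K t ω) ^ 8 +
        2 * vecNorm (η k ω).ofLp ^ 8))) ∂P :=
        integral_mono (((h.moments_score t i j).mul (h.moments_cost k)).pow 2).integrable
          (m1.add m2).integrable fun ω => (sq_score_mul_cost_le t k i j ω).trans
            (le_of_eq (by ring))
    _ = (‖S‖ + 2 * ‖R‖ * ‖K‖ ^ 2) ^ 2 * (1 / 2 * (∫ ω, vecNorm (η t ω).ofLp ^ 8 ∂P +
        ∫ ω, vecNorm (state A B η w K t ω) ^ 8 ∂P +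
          2 * ∫ ω, vecNorm (state A B η w K k ω) ^ 8 ∂P)) +
      (2 * ‖R‖) ^ 2 * (1 / 2 * (∫ ω, vecNorm (η t ω).ofLp ^ 8 ∂P +
        ∫ ω, vecNorm (state A B η w K t ω) ^ 8 ∂P +
          2 * ∫ ω, vecNorm (η k ω).ofLp ^ 8 ∂P)) := by
        rw [integral_add m1.integrable m2.integrable]
        simp only [integral_const_mul]
        rw [integral_add ((mη t).add (mx t)).integrable ((mx k).const_mul 2).integrable,
          integral_add ((mη t).add (mx t)).integrable ((mη k).const_mul 2).integrable,
          integral_add (mη t).integrable (mx t).integrable]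
        simp only [integral_const_mul]
    _ ≤ _ := by
        rw [scoreCostBound, productBound]
        have h1 := bη t
        have h2 := bx t
        have h3 := bx k
        have h4 := bη k
        gcongr <;> linarith

end MomentBounds

end LQR

namespace LQR

set_option linter.unusedSectionVars false

/-! ### Series of random variables and rearrangement -/

section Series

theorem ae_summable_and_integrable_tsum {Ω ι : Type*} [MeasurableSpace Ω] {P : Measure Ω}
    [Countable ι] {F : ι → Ω → ℝ} (hF : ∀ i, Integrable (F i) P)
    (hs : Summable fun i => ∫ ω, ‖F i ω‖ ∂P) :
    (∀ᵐ ω ∂P, Summable fun i => F i ω) ∧ Integrable (fun ω => ∑' i, F i ω) P := by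
  have hlint : ∫⁻ ω, ∑' i, ‖F i ω‖ₑ ∂P ≠ ⊤ := by
    rw [lintegral_tsum fun i => (hF i).1.enorm]
    have h1 : ∀ i, ∫⁻ ω, ‖F i ω‖ₑ ∂P = ENNReal.ofReal (∫ ω, ‖F i ω‖ ∂P) := fun i =>
      (ofReal_integral_norm_eq_lintegral_enorm (hF i)).symm
    simp only [h1]
    rw [← ENNReal.ofReal_tsum_of_nonneg (fun i => integral_nonneg fun ω => norm_nonneg _) hs]
    exact ENNReal.ofReal_ne_top
  have hmeas : AEMeasurable (fun ω => ∑' i, ‖F i ω‖ₑ) P :=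
    AEMeasurable.tsum fun i => (hF i).1.enorm
  have hsum : ∀ᵐ ω ∂P, Summable fun i => F i ω := by
    filter_upwards [ae_lt_top' hmeas hlint] with ω hω
    have h1 : Summable fun i => ‖F i ω‖₊ := ENNReal.tsum_coe_ne_top_iff_summable.1 hω.ne
    exact Summable.of_norm (NNReal.summable_coe.2 h1)
  refine ⟨hsum, ?_, ?_⟩
  · refine aestronglyMeasurable_of_tendsto_ae (Filter.atTop : Filter (Finset ι))
      (f := fun s ω => ∑ i ∈ s, F i ω) (fun s => ?_) ?_
    · exact (integrable_finsetSum s fun i _ => hF i).1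
    · filter_upwards [hsum] with ω hω
      exact hω.hasSum
  · refine lt_of_le_of_lt (lintegral_mono fun ω => ?_) (lt_top_iff_ne_top.2 hlint)
    exact enorm_tsum_le_tsum_enorm

/-- Regrouping along antidiagonals: a pair (score time `t`, delay `j`) is sorted by its cost time `k
= t + j`. -/
theorem tsum_prod_eq_tsum_sum_range {f : ℕ × ℕ → ℝ} (hf : Summable f) :
    ∑' p, f p = ∑' k, ∑ t ∈ Finset.range (k + 1), f (t, k - t) := by
  rw [← Finset.HasAntidiagonal.sigmaAntidiagonalEquivProd.tsum_eq f]
  refine ((Finset.HasAntidiagonal.sigmaAntidiagonalEquivProd.summable_iff.2 hf).tsum_sigma'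
    fun n => (hasSum_fintype _).summable).trans ?_
  refine tsum_congr fun k => ?_
  rw [← Finset.Nat.sum_antidiagonal_eq_sum_range_succ_mk, tsum_fintype]
  exact Finset.sum_coe_sort (Finset.HasAntidiagonal.antidiagonal k) f

theorem summable_pow_add {γ : ℝ} (h0 : 0 ≤ γ) (h1 : γ < 1) (C : ℝ) :
    Summable fun p : ℕ × ℕ => γ ^ (p.1 + p.2) * C := by
  have h := summable_geometric_of_lt_one h0 h1
  simp only [pow_add]
  exact (h.mul_of_nonneg h (fun k => pow_nonneg h0 k) fun k => pow_nonneg h0 k).mul_right C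

end Series

/-! ### The REINFORCE gradient and its truncation -/

section Reinforce

open scoped Matrix.Norms.L2Operator

variable {Ω : Type*} [MeasurableSpace Ω] {P : Measure Ω} [IsProbabilityMeasure P] {n d : ℕ}
  {A : Matrix (Fin n) (Fin n) ℝ} {B : Matrix (Fin n) (Fin d) ℝ}
  {S : Matrix (Fin n) (Fin n) ℝ} {R : Matrix (Fin d) (Fin d) ℝ} {Dω : Matrix (Fin n) (Fin n) ℝ}
  {γ σ : ℝ} {η : ℕ → Ω → EuclideanSpace ℝ (Fin d)} {w : ℕ → Ω → EuclideanSpace ℝ (Fin n)}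
  {K : Matrix (Fin d) (Fin n) ℝ} {Γ ρ : ℝ}

namespace IsNoise

theorem integral_discounted_quad (h : IsNoise P σ Dω η w) (t : ℕ) :
    ∫ ω, γ ^ t * (state A B η w K t ω ⬝ᵥ (S + Kᵀ * R * K) *ᵥ state A B η w K t ω) ∂P =
      γ ^ t * costMean A B S R (effCov P B η w) t K := by
  rw [integral_const_mul, h.integral_state_quad, costMean]

/-- The noise does not change with the policy, so the formula holds for every `K`, stable or not, as
an identity between `tsum`s. An equality of functions is what differentiation needs. -/
theorem J_eq (h : IsNoise P σ Dω η w) :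
    (fun K => J A B S R γ σ η w K P) = fun K =>
      (∑' t, γ ^ t * costMean A B S R (effCov P B η w) t K) + σ ^ 2 * R.trace / (1 - γ) := by
  ext K
  simp only [J, h.integral_discounted_quad]

theorem integrable_discounted_quad (h : IsNoise P σ Dω η w) (t : ℕ) :
    Integrable (fun ω => γ ^ t *
      (state A B η w K t ω ⬝ᵥ (S + Kᵀ * R * K) *ᵥ state A B η w K t ω)) P :=
  ((HasAllMoments.dotProduct (h.moments_state t)
    (HasAllMoments.mulVec _ (h.moments_state t))).const_mul _).integrable

theorem summable_discounted_costMean (hγ0 : 0 ≤ γ) (hγ1 : γ < 1) (hρ0 : 0 ≤ ρ) (hρ1 : ρ < 1)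
    (hM : ∀ k, ‖(A + B * K) ^ k‖ ≤ Γ * ρ ^ k) (D : Matrix (Fin n) (Fin n) ℝ) :
    Summable fun t => γ ^ t * costMean A B S R D t K := by
  refine Summable.of_norm_bounded
    ((summable_geometric_of_lt_one hγ0 hγ1).mul_right (traceNorm n * (‖S + Kᵀ * R * K‖ *
      (Γ ^ 2 * ‖D‖ * (1 / (1 - ρ ^ 2)))))) fun t => ?_
  rw [norm_mul, norm_pow, Real.norm_of_nonneg hγ0]
  gcongr
  exact abs_costMean_le hρ0 hρ1 hM t

theorem differentiableAt_J_and_hasSum_grad (h : IsNoise P σ Dω η w) (hγ0 : 0 ≤ γ) (hγ1 : γ < 1)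
    (hρ0 : 0 ≤ ρ) (hρ1 : ρ < 1) (hM : ∀ k, ‖(A + B * K) ^ k‖ ≤ Γ * ρ ^ k) :
    DifferentiableAt ℝ (fun K' => J A B S R γ σ η w K' P) K ∧
      ∀ i j, HasSum (fun t => γ ^ t *
        costDer A B S R (effCov P B η w) t K (Matrix.single i j 1))
          (grad (fun K' => J A B S R γ σ η w K' P) K i j) := by
  obtain ⟨L, hL, hsum⟩ := exists_hasFDerivAt_tsum_costMean (S := S) (R := R)
    (D := effCov P B η w) hγ0 hγ1 hρ0 hρ1 hM
  have hJ : HasFDerivAt (fun K' => J A B S R γ σ η w K' P) L K := by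
    rw [h.J_eq]
    exact hL.add_const _
  refine ⟨hJ.differentiableAt, fun i j => ?_⟩
  rw [grad, Matrix.of_apply, hJ.fderiv]
  exact hsum _

theorem exists_integral_abs_cost_le (h : IsNoise P σ Dω η w) (hρ0 : 0 ≤ ρ) (hρ1 : ρ < 1)
    (hM : ∀ k, ‖(A + B * K) ^ k‖ ≤ Γ * ρ ^ k) :
    ∃ C : ℝ, ∀ k, ∫ ω, |cost A B S R η w K k ω| ∂P ≤ C := by
  -- Crude, but it lets the eighth-moment bounds serve for the first moment of the cost.
  have e : ∀ x : ℝ, x ^ 2 ≤ 1 + x ^ 8 := fun x => by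
    nlinarith [sq_nonneg (x ^ 4 - 1 / 2), sq_nonneg (x ^ 2 - 1 / 2)]
  have mη := fun t => HasAllMoments.vecNorm_pow_eight (h.moments_η t)
  have mx := fun t =>
    HasAllMoments.vecNorm_pow_eight (h.moments_state (A := A) (B := B) (K := K) t)
  have bη := h.integral_η_pow_eight_le
  have bx := h.integral_state_pow_eight_le hρ0 hρ1 hM
  have one := HasAllMoments.const (P := P) (1 : ℝ)
  refine ⟨(‖S‖ + 2 * ‖R‖ * ‖K‖ ^ 2) * (1 + stateMoment n Γ (1 / (1 - ρ ^ 2)) (effCov P B η w)) +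
    2 * ‖R‖ * (1 + vecMoment (σ ^ 2 • (1 : Matrix (Fin d) (Fin d) ℝ))), fun k => ?_⟩
  have m1 := (one.add (mx k)).const_mul (‖S‖ + 2 * ‖R‖ * ‖K‖ ^ 2)
  have m2 := (one.add (mη k)).const_mul (2 * ‖R‖)
  calc _ ≤ ∫ ω, ((‖S‖ + 2 * ‖R‖ * ‖K‖ ^ 2) * (1 + vecNorm (state A B η w K k ω) ^ 8) +
        2 * ‖R‖ * (1 + vecNorm (η k ω).ofLp ^ 8)) ∂P := by
        refine integral_mono (h.moments_cost k).integrable.abs (m1.add m2).integrable fun ω => ?_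
        refine (abs_cost_le k ω).trans ?_
        have h1 := e (vecNorm (state A B η w K k ω))
        have h2 := e (vecNorm (η k ω).ofLp)
        simp only
        gcongr
    _ = (‖S‖ + 2 * ‖R‖ * ‖K‖ ^ 2) * (1 + ∫ ω, vecNorm (state A B η w K k ω) ^ 8 ∂P) +
        2 * ‖R‖ * (1 + ∫ ω, vecNorm (η k ω).ofLp ^ 8 ∂P) := by
        rw [integral_add m1.integrable m2.integrable, integral_const_mul, integral_const_mul,
          integral_add one.integrable (mx k).integrable,
          integral_add one.integrable (mη k).integrable]
        simp
    _ ≤ _ := by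
        have h1 := bx k
        have h2 := bη k
        gcongr

theorem ae_summable_cost (h : IsNoise P σ Dω η w) (hγ0 : 0 ≤ γ) (hγ1 : γ < 1)
    (hρ0 : 0 ≤ ρ) (hρ1 : ρ < 1) (hM : ∀ k, ‖(A + B * K) ^ k‖ ≤ Γ * ρ ^ k) :
    ∀ᵐ ω ∂P, Summable fun k : ℕ => γ ^ k * cost A B S R η w K k ω := by
  obtain ⟨C, hC⟩ := h.exists_integral_abs_cost_le (S := S) (R := R) hρ0 hρ1 hM
  refine (ae_summable_and_integrable_tsum
    (fun k => ((h.moments_cost k).const_mul (γ ^ k)).integrable) ?_).1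
  refine Summable.of_nonneg_of_le (fun k => integral_nonneg fun ω => norm_nonneg _) (fun k => ?_)
    ((summable_geometric_of_lt_one hγ0 hγ1).mul_right C)
  simp only [norm_mul, norm_pow, Real.norm_of_nonneg hγ0]
  rw [integral_const_mul]
  gcongr
  exact hC k

theorem integral_abs_score_mul_cost_le (h : IsNoise P σ Dω η w) (hρ0 : 0 ≤ ρ) (hρ1 : ρ < 1)
    (hM : ∀ k, ‖(A + B * K) ^ k‖ ≤ Γ * ρ ^ k) (t k : ℕ) (i : Fin d) (j : Fin n) :
    ∫ ω, |score A B η w K t ω i j * cost A B S R η w K k ω| ∂P ≤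
      1 + scoreCostBound n d ‖S‖ ‖R‖ ‖K‖ Γ (1 / (1 - ρ ^ 2)) (effCov P B η w) σ := by
  have m := (h.moments_score (A := A) (B := B) (K := K) t i j).mul
    (h.moments_cost (A := A) (B := B) (K := K) (S := S) (R := R) k)
  have one := HasAllMoments.const (P := P) (1 : ℝ)
  calc _ ≤ ∫ ω, (1 + (score A B η w K t ω i j * cost A B S R η w K k ω) ^ 2) ∂P := by
        refine integral_mono m.integrable.abs (one.add (m.pow 2)).integrable fun ω => ?_
        simp only
        nlinarith [sq_abs (score A B η w K t ω i j * cost A B S R η w K k ω),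
          sq_nonneg (|score A B η w K t ω i j * cost A B S R η w K k ω| - 1 / 2)]
    _ = 1 + ∫ ω, (score A B η w K t ω i j * cost A B S R η w K k ω) ^ 2 ∂P := by
        rw [integral_add one.integrable (m.pow 2).integrable]
        simp
    _ ≤ _ := by
        gcongr
        exact h.integral_sq_score_mul_cost_le hρ0 hρ1 hM t k i j

theorem summable_integral_norm_returns (h : IsNoise P σ Dω η w) (hγ0 : 0 ≤ γ) (hγ1 : γ < 1)
    (hρ0 : 0 ≤ ρ) (hρ1 : ρ < 1) (hM : ∀ k, ‖(A + B * K) ^ k‖ ≤ Γ * ρ ^ k) (i : Fin d)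
    (j : Fin n) :
    Summable fun p : ℕ × ℕ => ∫ ω, ‖γ ^ (p.1 + p.2) *
      (score A B η w K p.1 ω i j * cost A B S R η w K (p.1 + p.2) ω)‖ ∂P := by
  refine Summable.of_nonneg_of_le (fun k => integral_nonneg fun ω => norm_nonneg _) (fun p => ?_)
    (summable_pow_add hγ0 hγ1
      (1 + scoreCostBound n d ‖S‖ ‖R‖ ‖K‖ Γ (1 / (1 - ρ ^ 2)) (effCov P B η w) σ))
  simp only [norm_mul (γ ^ (p.1 + p.2)), norm_pow, Real.norm_of_nonneg hγ0]
  rw [integral_const_mul]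
  gcongr
  exact h.integral_abs_score_mul_cost_le hρ0 hρ1 hM _ _ i j

theorem integrable_return (h : IsNoise P σ Dω η w) (i : Fin d) (j : Fin n) (p : ℕ × ℕ) :
    Integrable (fun ω => γ ^ (p.1 + p.2) *
      (score A B η w K p.1 ω i j * cost A B S R η w K (p.1 + p.2) ω)) P :=
  (((h.moments_score _ i j).mul (h.moments_cost _)).const_mul _).integrable

theorem returnTerm_apply (ω : Ω) (t : ℕ) (i : Fin d) (j : Fin n) :
    returnTerm A B S R γ η w K ω t i j = ∑' m : ℕ, γ ^ (t + m) *
      (score A B η w K t ω i j * cost A B S R η w K (t + m) ω) := by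
  rw [returnTerm, Matrix.smul_apply, smul_eq_mul, ← tsum_mul_right]
  exact tsum_congr fun m => by ring

theorem ae_summable_returns (h : IsNoise P σ Dω η w) (hγ0 : 0 ≤ γ) (hγ1 : γ < 1)
    (hρ0 : 0 ≤ ρ) (hρ1 : ρ < 1) (hM : ∀ k, ‖(A + B * K) ^ k‖ ≤ Γ * ρ ^ k) :
    ∀ᵐ ω ∂P, ∀ i j, Summable fun p : ℕ × ℕ => γ ^ (p.1 + p.2) *
      (score A B η w K p.1 ω i j * cost A B S R η w K (p.1 + p.2) ω) := by
  rw [ae_all_iff]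
  intro i
  rw [ae_all_iff]
  intro j
  exact (ae_summable_and_integrable_tsum (h.integrable_return i j)
    (h.summable_integral_norm_returns hγ0 hγ1 hρ0 hρ1 hM i j)).1

theorem summable_returnTerm {ω : Ω} (hω : ∀ i j, Summable fun p : ℕ × ℕ => γ ^ (p.1 + p.2) *
      (score A B η w K p.1 ω i j * cost A B S R η w K (p.1 + p.2) ω)) :
    Summable fun t : ℕ => returnTerm A B S R γ η w K ω t := by
  refine Pi.summable.2 fun i => Pi.summable.2 fun j => ?_
  have h1 : ∀ t, returnTerm A B S R γ η w K ω t i j = ∑' m : ℕ, γ ^ (t + m) *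
      (score A B η w K t ω i j * cost A B S R η w K (t + m) ω) := fun t =>
    returnTerm_apply ω t i j
  simp only [h1]
  exact (hω i j).prod

theorem fullSample_apply {ω : Ω} (hω : ∀ i j, Summable fun p : ℕ × ℕ => γ ^ (p.1 + p.2) *
      (score A B η w K p.1 ω i j * cost A B S R η w K (p.1 + p.2) ω)) (i : Fin d) (j : Fin n) :
    fullSample A B S R γ σ η w K ω i j = (1 / σ ^ 2) * ∑' p : ℕ × ℕ, γ ^ (p.1 + p.2) *
      (score A B η w K p.1 ω i j * cost A B S R η w K (p.1 + p.2) ω) := by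
  have hs := summable_returnTerm hω
  have h1 : (∑' t : ℕ, returnTerm A B S R γ η w K ω t) i j =
      ∑' t : ℕ, returnTerm A B S R γ η w K ω t i j := by
    have e1 := tsum_apply (f := fun t => returnTerm A B S R γ η w K ω t) hs (x := i)
    have e2 := tsum_apply (Pi.summable.1 hs i) (x := j)
    exact (congrFun e1 j).trans e2
  rw [fullSample, Matrix.smul_apply, smul_eq_mul, h1]
  congr 1
  simp only [returnTerm_apply]
  exact ((hω i j).tsum_prod).symm

theorem integrableMat_fullSample (h : IsNoise P σ Dω η w) (hγ0 : 0 ≤ γ) (hγ1 : γ < 1)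
    (hρ0 : 0 ≤ ρ) (hρ1 : ρ < 1) (hM : ∀ k, ‖(A + B * K) ^ k‖ ≤ Γ * ρ ^ k) :
    IntegrableMat P (fullSample A B S R γ σ η w K) := by
  intro i j
  have h1 := (ae_summable_and_integrable_tsum (h.integrable_return (S := S) (R := R) i j)
    (h.summable_integral_norm_returns hγ0 hγ1 hρ0 hρ1 hM i j)).2
  refine (h1.const_mul (1 / σ ^ 2)).congr ?_
  filter_upwards [h.ae_summable_returns (S := S) (R := R) hγ0 hγ1 hρ0 hρ1 hM] with ω hω
  exact (fullSample_apply hω i j).symm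

/-- The REINFORCE gradient is the policy gradient. -/
theorem G_eq_grad_J (h : IsNoise P σ Dω η w) (hσ : σ ≠ 0) (hγ0 : 0 ≤ γ) (hγ1 : γ < 1)
    (hρ0 : 0 ≤ ρ) (hρ1 : ρ < 1) (hM : ∀ k, ‖(A + B * K) ^ k‖ ≤ Γ * ρ ^ k) :
    G A B S R γ σ η w K P = grad (fun K' => J A B S R γ σ η w K' P) K := by
  ext i j
  have hint := h.integrable_return (A := A) (B := B) (S := S) (R := R) (K := K) (γ := γ) i j
  have hnorm := h.summable_integral_norm_returns (S := S) (R := R) hγ0 hγ1 hρ0 hρ1 hM i j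
  have e1 : G A B S R γ σ η w K P i j = (1 / σ ^ 2) * ∫ ω, ∑' p : ℕ × ℕ, γ ^ (p.1 + p.2) *
      (score A B η w K p.1 ω i j * cost A B S R η w K (p.1 + p.2) ω) ∂P := by
    rw [G, expectMat, Matrix.of_apply, ← integral_const_mul]
    refine integral_congr_ae ?_
    filter_upwards [h.ae_summable_returns (S := S) (R := R) hγ0 hγ1 hρ0 hρ1 hM] with ω hω
    exact fullSample_apply hω i j
  have e2 := hasSum_integral_of_summable_integral_norm hint hnorm
  -- Both sides are now series over the cost time `k`, and the identity for a single cost matches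
  -- them term by term.
  rw [e1, ← e2.tsum_eq, tsum_prod_eq_tsum_sum_range e2.summable,
    ← ((h.differentiableAt_J_and_hasSum_grad hγ0 hγ1 hρ0 hρ1 hM).2 i j).tsum_eq,
    ← tsum_mul_left]
  refine tsum_congr fun k => ?_
  have e3 : ∀ t ∈ Finset.range (k + 1), ∫ ω, γ ^ (t + (k - t)) *
      (score A B η w K t ω i j * cost A B S R η w K (t + (k - t)) ω) ∂P =
      γ ^ k * ∫ ω, score A B η w K t ω i j * cost A B S R η w K k ω ∂P := by
    intro t ht
    have : t + (k - t) = k := by have := Finset.mem_range.1 ht; omega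
    rw [this, integral_const_mul]
  rw [Finset.sum_congr rfl e3, ← Finset.mul_sum, h.sum_integral_score_mul_cost]
  field_simp

theorem Ghat_apply (L : ℕ) (ω : Ω) (i : Fin d) (j : Fin n) :
    Ghat A B S R γ σ η w K L ω i j = (1 / σ ^ 2) * ∑ t ∈ Finset.Icc 0 L,
      ∑ k ∈ Finset.Icc t L, γ ^ k * (score A B η w K t ω i j * cost A B S R η w K k ω) := by
  rw [Ghat, Matrix.smul_apply, smul_eq_mul, Matrix.sum_apply]
  congr 1
  refine Finset.sum_congr rfl fun t _ => ?_
  rw [Matrix.smul_apply, smul_eq_mul, Finset.sum_mul]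
  exact Finset.sum_congr rfl fun k _ => by ring

theorem moments_Ghat (h : IsNoise P σ Dω η w) (L : ℕ) (i : Fin d) (j : Fin n) :
    HasAllMoments (fun ω => Ghat A B S R γ σ η w K L ω i j) P := by
  simp only [Ghat_apply]
  exact (HasAllMoments.sum fun t _ => HasAllMoments.sum fun k _ =>
    ((h.moments_score t i j).mul (h.moments_cost k)).const_mul _).const_mul _

theorem integral_Ghat_apply (h : IsNoise P σ Dω η w) (hσ : σ ≠ 0) (L : ℕ) (i : Fin d)
    (j : Fin n) :
    ∫ ω, Ghat A B S R γ σ η w K L ω i j ∂P = ∑ k ∈ Finset.range (L + 1), γ ^ k *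
      costDer A B S R (effCov P B η w) k K (Matrix.single i j 1) := by
  simp only [Ghat_apply]
  have m := fun t k => ((h.moments_score (A := A) (B := B) (K := K) t i j).mul
    (h.moments_cost (A := A) (B := B) (K := K) (S := S) (R := R) k)).const_mul (γ ^ k)
  rw [integral_const_mul, integral_finsetSum _ fun t _ =>
    (HasAllMoments.sum fun k _ => m t k).integrable]
  have e1 : ∀ t, ∫ ω, ∑ k ∈ Finset.Icc t L, γ ^ k *
      (score A B η w K t ω i j * cost A B S R η w K k ω) ∂P =
      ∑ k ∈ Finset.Icc t L, γ ^ k *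
        ∫ ω, score A B η w K t ω i j * cost A B S R η w K k ω ∂P := by
    intro t
    rw [integral_finsetSum _ fun k _ => (m t k).integrable]
    exact Finset.sum_congr rfl fun k _ => integral_const_mul _ _
  simp only [e1]
  -- On the triangle `t ≤ k ≤ L` each cost `c_k` meets all scores `t ≤ k`, so truncation keeps the
  -- single-cost identity intact for `k ≤ L`.
  rw [Finset.sum_comm' (t' := Finset.range (L + 1)) (s' := fun k => Finset.range (k + 1))
    (by intro x y; simp only [Finset.mem_Icc, Finset.mem_range]; omega), Finset.mul_sum]
  refine Finset.sum_congr rfl fun k _ => ?_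
  rw [← Finset.mul_sum, h.sum_integral_score_mul_cost]
  field_simp

/-- The bias of the truncated estimator is the tail of the discounted series. -/
theorem abs_grad_sub_integral_Ghat_le (h : IsNoise P σ Dω η w) (hσ : σ ≠ 0) (hγ0 : 0 ≤ γ)
    (hγ1 : γ < 1) (hρ0 : 0 ≤ ρ) (hρ1 : ρ < 1) (hM : ∀ k, ‖(A + B * K) ^ k‖ ≤ Γ * ρ ^ k)
    (L : ℕ) (i : Fin d) (j : Fin n) :
    |grad (fun K' => J A B S R γ σ η w K' P) K i j -
        ∫ ω, Ghat A B S R γ σ η w K L ω i j ∂P| ≤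
      derBound n ‖B‖ ‖S‖ ‖R‖ ‖K‖ Γ (1 / (1 - ρ ^ 2)) (effCov P B η w) *
        ‖(Matrix.single i j 1 : Matrix (Fin d) (Fin n) ℝ)‖ * (γ ^ (L + 1) * (1 / (1 - γ))) := by
  set C := derBound n ‖B‖ ‖S‖ ‖R‖ ‖K‖ Γ (1 / (1 - ρ ^ 2)) (effCov P B η w) *
    ‖(Matrix.single i j 1 : Matrix (Fin d) (Fin n) ℝ)‖
  have hs := (h.differentiableAt_J_and_hasSum_grad (S := S) (R := R) (A := A) (B := B) (K := K)
    hγ0 hγ1 hρ0 hρ1 hM).2 i j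
  rw [h.integral_Ghat_apply hσ, ← hs.tsum_eq, ← hs.summable.sum_add_tsum_nat_add (L + 1),
    add_sub_cancel_left, ← Real.norm_eq_abs]
  have hg := (hasSum_geometric_of_lt_one hγ0 hγ1).mul_left (C * γ ^ (L + 1))
  have hv : C * (γ ^ (L + 1) * (1 / (1 - γ))) = C * γ ^ (L + 1) * (1 - γ)⁻¹ := by
    rw [one_div]; ring
  rw [hv]
  refine tsum_of_norm_bounded hg fun k => ?_
  rw [norm_mul, norm_pow, Real.norm_of_nonneg hγ0, Real.norm_eq_abs, pow_add]
  have hb := abs_costDer_le (A := A) (S := S) (R := R) (D := effCov P B η w) hρ0 hρ1 hM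
    (le_refl ‖K‖) (k + (L + 1)) (Matrix.single i j 1)
  calc _ ≤ γ ^ k * γ ^ (L + 1) * C := by gcongr
    _ = _ := by ring

/-- Since `x₀ = 0`, the summand `t = 0` drops out of the estimator. This is what gives `L ^ 3`
rather than `(L + 1) ^ 3`, and makes the bound true at `L = 0`. -/
theorem score_zero (ω : Ω) (i : Fin d) (j : Fin n) : score A B η w K 0 ω i j = 0 := by
  simp [score_apply, state]

theorem sq_Ghat_apply_le (L : ℕ) (ω : Ω) (i : Fin d) (j : Fin n) :
    Ghat A B S R γ σ η w K L ω i j ^ 2 ≤ (1 / σ ^ 2) ^ 2 * (L * ∑ t ∈ Finset.Icc 1 L,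
      (L * ∑ k ∈ Finset.range (L + 1), (γ ^ 2) ^ k *
        (score A B η w K t ω i j * cost A B S R η w K k ω) ^ 2)) := by
  have h0 : ∑ t ∈ Finset.Icc 0 L, ∑ k ∈ Finset.Icc t L,
      γ ^ k * (score A B η w K t ω i j * cost A B S R η w K k ω) =
      ∑ t ∈ Finset.Icc 1 L, ∑ k ∈ Finset.Icc t L,
        γ ^ k * (score A B η w K t ω i j * cost A B S R η w K k ω) := by
    refine (Finset.sum_subset (Finset.Icc_subset_Icc_left zero_le_one) fun t ht ht' => ?_).symm
    have : t = 0 := by simp only [Finset.mem_Icc] at ht ht'; omega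
    simp [this, score_zero]
  rw [Ghat_apply, h0, mul_pow]
  gcongr
  refine sq_sum_le_card_mul_sum_sq.trans ?_
  rw [Nat.card_Icc, Nat.add_sub_cancel]
  gcongr with t ht
  refine sq_sum_le_card_mul_sum_sq.trans ?_
  have h1t : 1 ≤ t := (Finset.mem_Icc.1 ht).1
  rw [Nat.card_Icc]
  -- For `t ≥ 1` there are at most `L` costs, which bounds the Cauchy–Schwarz factor; enlarging the
  -- sum afterwards makes its index range independent of `t`.
  have hsub : Finset.Icc t L ⊆ Finset.range (L + 1) := fun k hk => by
    simp only [Finset.mem_Icc, Finset.mem_range] at hk ⊢; omega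
  have hle : ((L + 1 - t : ℕ) : ℝ) ≤ L := by exact_mod_cast (by omega : L + 1 - t ≤ L)
  have e : ∀ k, (γ ^ k * (score A B η w K t ω i j * cost A B S R η w K k ω)) ^ 2 =
      (γ ^ 2) ^ k * (score A B η w K t ω i j * cost A B S R η w K k ω) ^ 2 := fun k => by
    rw [mul_pow, ← pow_mul, ← pow_mul, mul_comm k 2]
  simp only [e]
  refine mul_le_mul hle (Finset.sum_le_sum_of_subset_of_nonneg hsub fun k _ _ => by positivity)
    (Finset.sum_nonneg fun k _ => by positivity) (Nat.cast_nonneg L)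

theorem integral_sq_Ghat_apply_le (h : IsNoise P σ Dω η w) (hγ0 : 0 ≤ γ) (hγ1 : γ < 1)
    (hρ0 : 0 ≤ ρ) (hρ1 : ρ < 1) (hM : ∀ k, ‖(A + B * K) ^ k‖ ≤ Γ * ρ ^ k)
    (L : ℕ) (i : Fin d) (j : Fin n) :
    ∫ ω, Ghat A B S R γ σ η w K L ω i j ^ 2 ∂P ≤ (1 / σ ^ 2) ^ 2 *
      scoreCostBound n d ‖S‖ ‖R‖ ‖K‖ Γ (1 / (1 - ρ ^ 2)) (effCov P B η w) σ *
        ((L : ℝ) ^ 3 / (1 - γ ^ 2)) := by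
  set C := scoreCostBound n d ‖S‖ ‖R‖ ‖K‖ Γ (1 / (1 - ρ ^ 2)) (effCov P B η w) σ
  have hC0 : 0 ≤ C := (integral_nonneg fun ω => sq_nonneg _).trans
    (h.integral_sq_score_mul_cost_le hρ0 hρ1 hM 0 0 i j)
  have m := fun t k => (((h.moments_score (A := A) (B := B) (K := K) t i j).mul
    (h.moments_cost (A := A) (B := B) (K := K) (S := S) (R := R) k)).pow 2).const_mul
      ((γ ^ 2) ^ k)
  have m' := fun t => (HasAllMoments.sum (s := Finset.range (L + 1)) fun k _ => m t k).const_mul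
    (L : ℝ)
  calc _ ≤ ∫ ω, (1 / σ ^ 2) ^ 2 * (L * ∑ t ∈ Finset.Icc 1 L,
        (L * ∑ k ∈ Finset.range (L + 1), (γ ^ 2) ^ k *
          (score A B η w K t ω i j * cost A B S R η w K k ω) ^ 2)) ∂P :=
        integral_mono ((h.moments_Ghat L i j).pow 2).integrable
          (((HasAllMoments.sum fun t _ => m' t).const_mul _).const_mul _).integrable
          fun ω => sq_Ghat_apply_le L ω i j
    _ = (1 / σ ^ 2) ^ 2 * (L * ∑ t ∈ Finset.Icc 1 L,
        (L * ∑ k ∈ Finset.range (L + 1), (γ ^ 2) ^ k *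
          ∫ ω, (score A B η w K t ω i j * cost A B S R η w K k ω) ^ 2 ∂P)) := by
        rw [integral_const_mul, integral_const_mul, integral_finsetSum _ fun t _ =>
          (m' t).integrable]
        congr 2
        refine Finset.sum_congr rfl fun t _ => ?_
        rw [integral_const_mul, integral_finsetSum _ fun k _ => (m t k).integrable]
        congr 1
        exact Finset.sum_congr rfl fun k _ => integral_const_mul _ _
    _ ≤ (1 / σ ^ 2) ^ 2 * (L * ∑ t ∈ Finset.Icc 1 L,
        (L * ∑ k ∈ Finset.range (L + 1), (γ ^ 2) ^ k * C)) := by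
        gcongr with t _ k _
        exact h.integral_sq_score_mul_cost_le hρ0 hρ1 hM t k i j
    _ ≤ (1 / σ ^ 2) ^ 2 * (L * ∑ t ∈ Finset.Icc 1 L, (L * (1 / (1 - γ ^ 2) * C))) := by
        gcongr with t _
        rw [← Finset.sum_mul]
        gcongr
        exact geom_sum_sq_le hγ0 hγ1 (L + 1)
    _ = _ := by
        rw [Finset.sum_const, Nat.card_Icc, Nat.add_sub_cancel, nsmul_eq_mul]
        ring

end IsNoise

theorem frobNorm_sq {m l : ℕ} (M : Matrix (Fin m) (Fin l) ℝ) :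
    frobNorm M ^ 2 = ∑ i, ∑ j, M i j ^ 2 := by
  have h := Matrix.frobenius_norm_def M
  change frobNorm M = _ at h
  rw [h, ← Real.sqrt_eq_rpow, Real.sq_sqrt]
  · simp
  · positivity

namespace IsNoise

theorem integrable_frobNorm_sq_Ghat (h : IsNoise P σ Dω η w) (L : ℕ) :
    Integrable (fun ω => frobNorm (Ghat A B S R γ σ η w K L ω) ^ 2) P := by
  simp only [frobNorm_sq]
  exact (HasAllMoments.sum fun i _ => HasAllMoments.sum fun j _ =>
    (h.moments_Ghat L i j).pow 2).integrable

theorem integral_frobNorm_sq_Ghat_le (h : IsNoise P σ Dω η w) (hγ0 : 0 ≤ γ) (hγ1 : γ < 1)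
    (hρ0 : 0 ≤ ρ) (hρ1 : ρ < 1) (hM : ∀ k, ‖(A + B * K) ^ k‖ ≤ Γ * ρ ^ k) (L : ℕ) :
    ∫ ω, frobNorm (Ghat A B S R γ σ η w K L ω) ^ 2 ∂P ≤ d * (n * ((1 / σ ^ 2) ^ 2 *
      scoreCostBound n d ‖S‖ ‖R‖ ‖K‖ Γ (1 / (1 - ρ ^ 2)) (effCov P B η w) σ)) *
        ((L : ℝ) ^ 3 / (1 - γ ^ 2)) := by
  simp only [frobNorm_sq]
  have m := fun i j => (h.moments_Ghat (A := A) (B := B) (K := K) (S := S) (R := R) (γ := γ)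
    L i j).pow 2
  rw [integral_finsetSum _ fun i _ => (HasAllMoments.sum fun j _ => m i j).integrable]
  have e : ∀ i, ∫ ω, ∑ j, Ghat A B S R γ σ η w K L ω i j ^ 2 ∂P =
      ∑ j, ∫ ω, Ghat A B S R γ σ η w K L ω i j ^ 2 ∂P := fun i =>
    integral_finsetSum _ fun j _ => (m i j).integrable
  simp only [e]
  refine (Finset.sum_le_sum fun i _ => Finset.sum_le_sum fun j _ =>
    h.integral_sq_Ghat_apply_le hγ0 hγ1 hρ0 hρ1 hM L i j).trans (le_of_eq ?_)
  simp only [Finset.sum_const, Finset.card_univ, Fintype.card_fin, nsmul_eq_mul]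
  ring

end IsNoise

/-- The sum of the squared spectral norms of the matrix units. -/
noncomputable def unitNormSum (d n : ℕ) : ℝ :=
  ∑ i, ∑ j, ‖(Matrix.single i j 1 : Matrix (Fin d) (Fin n) ℝ)‖ ^ 2

namespace IsNoise

/-- The norm of a matrix unit enters twice, from the derivative in that direction and from
reassembling the entries, hence the squares in `unitNormSum`. -/
theorem norm_grad_sub_expectMat_Ghat_le (h : IsNoise P σ Dω η w) (hσ : σ ≠ 0) (hγ0 : 0 ≤ γ)
    (hγ1 : γ < 1) (hρ0 : 0 ≤ ρ) (hρ1 : ρ < 1) (hM : ∀ k, ‖(A + B * K) ^ k‖ ≤ Γ * ρ ^ k)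
    (L : ℕ) :
    ‖grad (fun K' => J A B S R γ σ η w K' P) K - expectMat P (Ghat A B S R γ σ η w K L)‖ ≤
      unitNormSum d n * derBound n ‖B‖ ‖S‖ ‖R‖ ‖K‖ Γ (1 / (1 - ρ ^ 2)) (effCov P B η w) *
        (γ ^ (L + 1) * (1 / (1 - γ))) := by
  refine (norm_matrix_le_sum _).trans ?_
  rw [unitNormSum, Finset.sum_mul, Finset.sum_mul]
  refine Finset.sum_le_sum fun i _ => ?_
  rw [Finset.sum_mul, Finset.sum_mul]
  refine Finset.sum_le_sum fun j _ => ?_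
  have h1 := h.abs_grad_sub_integral_Ghat_le (S := S) (R := R) hσ hγ0 hγ1 hρ0 hρ1 hM L i j
  rw [Matrix.sub_apply, expectMat, Matrix.of_apply]
  refine (mul_le_mul_of_nonneg_right h1 (norm_nonneg _)).trans (le_of_eq ?_)
  ring

end IsNoise

/-- A power bound for positive exponents extends to all exponents. -/
theorem pow_bound_max_one {M : Matrix (Fin n) (Fin n) ℝ} (hρ0 : 0 ≤ ρ)
    (hM : ∀ k : ℕ, 1 ≤ k → ‖M ^ k‖ ≤ Γ * ρ ^ k) (k : ℕ) : ‖M ^ k‖ ≤ max 1 Γ * ρ ^ k := by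
  rcases Nat.eq_zero_or_pos k with rfl | hk
  · simpa using Or.inl (norm_matrix_one_le n)
  · exact (hM k hk).trans (by gcongr; exact le_max_right _ _)

/-- The bias is really of order `g / (1 - γ)`. Dividing the constant by `c * κ` cancels the outer
factor, and the inner `c * κ` only adds a nonnegative term. -/
theorem mul_geom_le_bias_factor {c κ g γ D : ℝ} (hc : 0 < c) (hκ : 0 < κ) (hD : 0 ≤ D)
    (hg : 0 ≤ g) :
    D * (g * (1 / (1 - γ))) ≤ D / (c * κ) * (c * κ) * g * (c * κ + 1 / (1 - γ)) := by
  rw [div_mul_cancel₀ _ (mul_pos hc hκ).ne']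
  have : 0 ≤ D * g * (c * κ) := by positivity
  linarith

end Reinforce

end LQR

theorem lemma5p1 (n d : ℕ) :
    -- `C₂` and `C₃` are fixed before the system, the noise, the discount factor, the policy and
    -- the horizon; they see these only through the listed arguments
    ∃ (C₂ : ℝ → ℝ → ℝ → ℝ → ℝ → ℝ → ℝ → Matrix (Fin n) (Fin n) ℝ → ℝ → ℝ)
      (C₃ : ℝ → ℝ → ℝ → ℝ → ℝ → ℝ → ℝ → Matrix (Fin n) (Fin n) ℝ → ℝ → ℝ → ℝ),
    ∀ (Ω : Type*) [MeasurableSpace Ω] (P : Measure Ω) [IsProbabilityMeasure P]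
      (A : Matrix (Fin n) (Fin n) ℝ) (B : Matrix (Fin n) (Fin d) ℝ)
      (S : Matrix (Fin n) (Fin n) ℝ) (R : Matrix (Fin d) (Fin d) ℝ)
      (Dω : Matrix (Fin n) (Fin n) ℝ) (γ σ : ℝ)
      (η : ℕ → Ω → EuclideanSpace ℝ (Fin d)) (w : ℕ → Ω → EuclideanSpace ℝ (Fin n))
      (K : Matrix (Fin d) (Fin n) ℝ),
      S.PosDef → R.PosDef → Dω.PosSemidef → 0 < γ → γ < 1 → 0 < σ →
      LQR.IsNoise P σ Dω η w → LQR.StablePolicy A B K →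
      -- the gradient of `J` exists at `K`, all series and expectations converge, `G(K) = ∇J(K)`
      ((∀ t, Integrable (fun ω => γ ^ t * (LQR.state A B η w K t ω ⬝ᵥ
          (S + Kᵀ * R * K) *ᵥ LQR.state A B η w K t ω)) P) ∧
        Summable (fun t : ℕ => ∫ ω, γ ^ t * (LQR.state A B η w K t ω ⬝ᵥ
          (S + Kᵀ * R * K) *ᵥ LQR.state A B η w K t ω) ∂P) ∧
        DifferentiableAt ℝ (fun K' => LQR.J A B S R γ σ η w K' P) K ∧
        (∀ᵐ ω ∂P, Summable fun k : ℕ => γ ^ k * LQR.cost A B S R η w K k ω) ∧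
        (∀ᵐ ω ∂P, Summable fun t : ℕ => LQR.returnTerm A B S R γ η w K ω t) ∧
        LQR.IntegrableMat P (LQR.fullSample A B S R γ σ η w K) ∧
        LQR.G A B S R γ σ η w K P = LQR.grad (fun K' => LQR.J A B S R γ σ η w K' P) K) ∧
      -- bias and second moment of the truncated estimator
      (∀ ρ Γ : ℝ, LQR.specRad (A + B * K) < ENNReal.ofReal ρ → ρ < 1 → 0 < Γ →
        (∀ k : ℕ, 1 ≤ k → LQR.opNorm ((A + B * K) ^ k) ≤ Γ * ρ ^ k) →
        ∀ L : ℕ,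
          LQR.IntegrableMat P (LQR.Ghat A B S R γ σ η w K L) ∧
          LQR.opNorm (LQR.grad (fun K' => LQR.J A B S R γ σ η w K' P) K -
              LQR.expectMat P (LQR.Ghat A B S R γ σ η w K L)) ≤
            C₂ (LQR.opNorm A) (LQR.opNorm B) (LQR.opNorm S) (LQR.opNorm R) (LQR.opNorm K) Γ
                (1 / (1 - ρ ^ 2)) (LQR.effCov P B η w) ((1 - γ) * LQR.J A B S R γ σ η w K P) *
              (Γ ^ 2 / (1 - ρ ^ 2)) * γ ^ (L + 1) *
              (Γ ^ 2 / (1 - ρ ^ 2) + 1 / (1 - γ)) ∧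
          Integrable (fun ω => LQR.frobNorm (LQR.Ghat A B S R γ σ η w K L ω) ^ 2) P ∧
          ∫ ω, LQR.frobNorm (LQR.Ghat A B S R γ σ η w K L ω) ^ 2 ∂P ≤
            C₃ (LQR.opNorm A) (LQR.opNorm B) (LQR.opNorm S) (LQR.opNorm R) (LQR.opNorm K) Γ
                (1 / (1 - ρ ^ 2)) (LQR.effCov P B η w) ((1 - γ) * LQR.J A B S R γ σ η w K P) σ *
              ((L : ℝ) ^ 3 / (1 - γ ^ 2))) := by
  -- The power bound is assumed only for `k ≥ 1`; `max 1 Γ` also covers `k = 0`. Division by `Γ ^ 2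
  -- * κ` compensates the prefactor of the bias bound, and `d * n` counts the entries in the
  -- Frobenius norm.
  refine ⟨fun _ b s r k Γ κ D _ => LQR.unitNormSum d n *
      LQR.derBound n b s r k (max 1 Γ) κ D / (Γ ^ 2 * κ),
    fun _ _ s r k Γ κ D _ σ => d * (n * ((1 / σ ^ 2) ^ 2 *
      LQR.scoreCostBound n d s r k (max 1 Γ) κ D σ)), ?_⟩
  intro Ω _ P _ A B S R Dω γ σ η w K _ _ _ hγ0 hγ1 hσ h hK
  refine ⟨?_, ?_⟩
  -- The claims of this half do not mention a rate, so any `ρ'` between the spectral radius and `1`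
  -- will do.
  · obtain ⟨ρ', hρ1, hρ2⟩ := ENNReal.lt_iff_exists_nnreal_btwn.1 hK
    have hρ : LQR.specRad (A + B * K) < ENNReal.ofReal ρ' := by simpa using hρ1
    have hρ' : (ρ' : ℝ) < 1 := by exact_mod_cast hρ2
    obtain ⟨Γ, -, hM⟩ := LQR.exists_pow_bound_of_specRad_lt hρ
    have hdiff := h.differentiableAt_J_and_hasSum_grad (S := S) (R := R) hγ0.le hγ1 ρ'.2 hρ' hM
    refine ⟨h.integrable_discounted_quad, ?_, hdiff.1,
      h.ae_summable_cost hγ0.le hγ1 ρ'.2 hρ' hM, ?_,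
      h.integrableMat_fullSample hγ0.le hγ1 ρ'.2 hρ' hM,
      h.G_eq_grad_J hσ.ne' hγ0.le hγ1 ρ'.2 hρ' hM⟩
    · simp only [h.integral_discounted_quad]
      exact LQR.IsNoise.summable_discounted_costMean hγ0.le hγ1 ρ'.2 hρ' hM _
    · filter_upwards [h.ae_summable_returns (S := S) (R := R) hγ0.le hγ1 ρ'.2 hρ' hM] with ω hω
      exact LQR.IsNoise.summable_returnTerm hω
  · intro ρ Γ hρ hρ1 hΓ hpow L
    have hρ0 : 0 < ρ := ENNReal.ofReal_pos.1 (bot_lt_of_lt hρ)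
    have hM := LQR.pow_bound_max_one hρ0.le hpow
    have hκ : 0 < 1 / (1 - ρ ^ 2) := one_div_pos.2 (by nlinarith)
    refine ⟨fun i j => (h.moments_Ghat L i j).integrable, ?_, h.integrable_frobNorm_sq_Ghat L,
      h.integral_frobNorm_sq_Ghat_le hγ0.le hγ1 hρ0.le hρ1 hM L⟩
    refine (h.norm_grad_sub_expectMat_Ghat_le hσ.ne' hγ0.le hγ1 hρ0.le hρ1 hM L).trans ?_
    have hD : 0 ≤ LQR.unitNormSum d n * LQR.derBound n (LQR.opNorm B) (LQR.opNorm S)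
        (LQR.opNorm R) (LQR.opNorm K) (max 1 Γ) (1 / (1 - ρ ^ 2)) (LQR.effCov P B η w) :=
      mul_nonneg (Finset.sum_nonneg fun i _ => Finset.sum_nonneg fun j _ => sq_nonneg _)
        (LQR.derBound_nonneg (LQR.opNorm_nonneg _) (LQR.opNorm_nonneg _) (LQR.opNorm_nonneg _)
          (LQR.opNorm_nonneg _)
          (le_max_of_le_left zero_le_one) hκ.le _)
    rw [div_eq_mul_one_div (Γ ^ 2)]
    exact LQR.mul_geom_le_bias_factor (pow_pos hΓ 2) hκ hD (pow_nonneg hγ0.le _)
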